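/- Let $R$ and $S$ be associative rings with unit, and let $C={}_SC_R$ be an $(S,R)$-bimodule. A module is *super finitely presented* if it has a projective resolution by finitely generated projective modules. $C$ is *semidualizing* if ${}_SC$ and $C_R$ are super finitely presented, the homothety maps $S\to \operatorname{Hom}_{R^{op}}(C,C)$ and $R\to\operatorname{Hom}_S(C,C)$ are isomorphisms, and $\operatorname{Ext}^i_S(C,C)=0=\operatorname{Ext}^i_{R^{op}}(C,C)$ for all $i\ge 1$; it is *faithfully semidualizing* if moreover, for every left $S$-module $N$ and every right $R$-module $M$, $\operatorname{Hom}_S(C,N)=0$ implies $N=0$ and $\operatorname{Hom}_{R^{op}}(C,M)=0$ implies $M=0$. The *Auslander class* $\mathcal A_C(R)$ consists of the left $R$-modules $M$ with $\operatorname{Tor}^R_i(C,M)=0=\operatorname{Ext}^i_S(C,C\otimes_RM)$ for all $i\ge1$ for which the evaluation map $M\to\operatorname{Hom}_S(C,C\otimes_RM)$ is bijective. The *Bass class* $\mathcal B_C(S)$ consists of the left $S$-modules $N$ with $\operatorname{Ext}^i_S(C,N)=0=\operatorname{Tor}^R_i(C,\operatorname{Hom}_S(C,N))$ for all $i\ge1$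 for which the evaluation map $C\otimes_R\operatorname{Hom}_S(C,N)\to N$ is bijective. A left $S$-module $M$ is *weak injective* if $\operatorname{Ext}^1_S(F,M)=0$ for all super finitely presented left $S$-modules $F$; its *weak injective dimension* is the infimum of the integers $n\ge 0$ such that $\operatorname{Ext}_S^{n+1}(F,M)=0$ for all such $F$ ($\infty$ if there is none). A left $R$-module $M$ is *weak flat* if $\operatorname{Tor}_1^R(F,M)=0$ for all super finitely presented right $R$-modules $F$; its *weak flat dimension* is the infimum of the integers $n\ge 0$ such that $\operatorname{Tor}^R_{n+1}(F,M)=0$ for all such $F$ ($\infty$ if there is none). Let $\mathcal{WI}(S)$ and $\mathcal{WF}(R)$ be the classes of weak injective left $S$-modules and weak flat left $R$-modules, and let $\mathcal{WI}(S)_{\le n}$ and $\mathcal{WF}(R)_{\le n}$ be the classes of left $S$-modules of weak injective dimension at most $n$ and of left $R$-modules of weak flat dimension at most $n$. Let $\mathcal{WF}_C(S)$ be the class of left $S$-modules isomorphic to $C\otimes_RF$ with $F\in\mathcal{WF}(R)$, and $\mathcal{WI}_C(R)$ the class of left $R$-modules isomorphic to $\operatorname{Hom}_S(C,I)$ with $I\in\mathcal{WI}(S)$.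 Let $\mathcal{WF}_C(S)_{\le n}$ be the class of left $S$-modules $M$ that have an exact sequence $0\to X_n\to\cdots\to X_0\to M\to0$ with all $X_i\in\mathcal{WF}_C(S)$, and $\mathcal{WI}_C(R)_{\le n}$ the class of left $R$-modules $M$ that have an exact sequence $0\to M\to X^0\to\cdots\to X^n\to0$ with all $X^i\in\mathcal{WI}_C(R)$. **Theorem (Foxby Equivalence).** Let $C={}_SC_R$ be a faithfully semidualizing bimodule and $n\ge0$ an integer. Then the functors $C\otimes_R-$ and $\operatorname{Hom}_S(C,-)$ restrict to mutually inverse equivalences of categories between the full subcategories $$\mathcal{WF}(R)\simeq\mathcal{WF}_C(S),\quad \mathcal{WF}(R)_{\le n}\simeq\mathcal{WF}_C(S)_{\le n},\quad \mathcal A_C(R)\simeq\mathcal B_C(S),\quad \mathcal{WI}_C(R)_{\le n}\simeq\mathcal{WI}(S)_{\le n},\quad \mathcal{WI}_C(R)\simeq\mathcal{WI}(S),$$ and there are inclusions $$\mathcal{WF}(R)\subseteq\mathcal{WF}(R)_{\le n}\subseteq\mathcal A_C(R)\supseteq\mathcal{WI}_C(R)_{\le n}\supseteq\mathcal{WI}_C(R),$$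 $$\mathcal{WF}_C(S)\subseteq\mathcal{WF}_C(S)_{\le n}\subseteq\mathcal B_C(S)\supseteq\mathcal{WI}(S)_{\le n}\supseteq\mathcal{WI}(S).$$ -/

import Mathlib

open CategoryTheory TensorProduct

universe u w

namespace Foxby

section BalancedTensor

variable (R : Type u) [Ring R] (S : Type w) [Ring S]
variable (C : Type u) [AddCommGroup C] [Module S C] [Module Rᵐᵒᵖ C]

/-- The balancing relations `cr ⊗ m = c ⊗ rm` inside `C ⊗_ℤ M`.  When `C` is an
`(S, R)`-bimodule the generating set is stable under `s • -`, so that its `S`-span is the additive subgroup that it generates. -/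
def balanceRel (M : Type u) [AddCommGroup M] [Module R M] : Submodule S (C ⊗[ℤ] M) :=
  Submodule.span S
    {x | ∃ (c : C) (r : R) (m : M), x = (MulOpposite.op r • c) ⊗ₜ[ℤ] m - c ⊗ₜ[ℤ] (r • m)}

/-- The tensor product `C ⊗_R M` of an `(S, R)`-bimodule `C` and a left `R`-module `M` (over a ring
`R` that need not be commutative), a left `S`-module.  A right `R`-module structure is a left
`Rᵐᵒᵖ`-module structure. -/
abbrev BalTensor (M : Type u) [AddCommGroup M] [Module R M] : Type u :=
  (C ⊗[ℤ] M) ⧸ balanceRel R S C M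

variable {C} in
/-- The pure tensor `c ⊗ m` in `C ⊗_R M`. -/
def BalTensor.tmul {M : Type u} [AddCommGroup M] [Module R M] (c : C) (m : M) :
    BalTensor R S C M :=
  (balanceRel R S C M).mkQ (c ⊗ₜ[ℤ] m)

theorem BalTensor.smul_tmul {M : Type u} [AddCommGroup M] [Module R M] (r : R) (c : C) (m : M) :
    BalTensor.tmul R S (MulOpposite.op r • c) m = BalTensor.tmul R S c (r • m) :=
  (Submodule.Quotient.eq _).2 (Submodule.subset_span ⟨c, r, m, rfl⟩)

/-- The `S`-linear map `C ⊗_R f : C ⊗_R M → C ⊗_R M'`, `c ⊗ m ↦ c ⊗ f m`. -/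
def BalTensor.map {M M' : Type u} [AddCommGroup M] [Module R M] [AddCommGroup M'] [Module R M']
    (f : M →ₗ[R] M') : BalTensor R S C M →ₗ[S] BalTensor R S C M' :=
  Submodule.mapQ _ _
    (TensorProduct.AlgebraTensorModule.map (R := ℤ) (LinearMap.id : C →ₗ[S] C)
      f.toAddMonoidHom.toIntLinearMap)
    (by
      refine Submodule.span_le.2 ?_
      rintro _ ⟨c, r, m, rfl⟩
      refine Submodule.subset_span ⟨c, r, f m, ?_⟩
      simp)

@[simp]
theorem BalTensor.map_tmul {M M' : Type u} [AddCommGroup M] [Module R M] [AddCommGroup M']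
    [Module R M'] (f : M →ₗ[R] M') (c : C) (m : M) :
    BalTensor.map R S C f (BalTensor.tmul R S c m) = BalTensor.tmul R S c (f m) := by
  change (balanceRel R S C M').mkQ (AlgebraTensorModule.map _ _ (c ⊗ₜ[ℤ] m)) = _
  rw [AlgebraTensorModule.map_tmul]
  rfl

variable {R S C} in
theorem BalTensor.hom_ext {M : Type u} [AddCommGroup M] [Module R M] {P : Type*} [AddCommGroup P]
    [Module S P] {f g : BalTensor R S C M →ₗ[S] P}
    (h : ∀ c m, f (BalTensor.tmul R S c m) = g (BalTensor.tmul R S c m)) : f = g := by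
  refine Submodule.linearMap_qext _ ?_
  ext c m
  exact h c m

/-- The functor `C ⊗_R -` from left `R`-modules to left `S`-modules. -/
def tensorFunctor : ModuleCat.{u} R ⥤ ModuleCat.{u} S where
  obj M := ModuleCat.of S (BalTensor R S C M)
  map f := ModuleCat.ofHom (BalTensor.map R S C f.hom)
  map_id M := by
    ext1
    exact BalTensor.hom_ext fun c m => by simp
  map_comp f g := by
    ext1
    exact BalTensor.hom_ext fun c m => by simp

instance : (tensorFunctor R S C).Additive where
  map_add {M M' f g} := by
    ext1
    refine BalTensor.hom_ext fun c m => ?_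
    change BalTensor.map R S C (f.hom + g.hom) _ = BalTensor.map R S C f.hom _ +
      BalTensor.map R S C g.hom _
    simp only [BalTensor.map_tmul]
    change (balanceRel R S C M').mkQ _ = (balanceRel R S C M').mkQ _ + (balanceRel R S C M').mkQ _
    rw [LinearMap.add_apply, TensorProduct.tmul_add, map_add]

end BalancedTensor

section BimoduleHom

variable (R : Type u) [Ring R] (S : Type w) [Ring S]
variable (C : Type u) [AddCommGroup C] [Module S C] [Module Rᵐᵒᵖ C] [SMulCommClass S Rᵐᵒᵖ C]

/-- The homothety `C → C`, `c ↦ s c`, as a map of right `R`-modules. -/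
def homothetyLeft (s : S) : C →ₗ[Rᵐᵒᵖ] C where
  toFun c := s • c
  map_add' := smul_add s
  map_smul' r c := smul_comm s r c

/-- The homothety `C → C`, `c ↦ c r`, as a map of left `S`-modules. -/
def homothetyRight (r : R) : C →ₗ[S] C where
  toFun c := MulOpposite.op r • c
  map_add' := smul_add _
  map_smul' s c := (smul_comm s (MulOpposite.op r) c).symm

/-- `Hom_S(C, N)` for an `(S, R)`-bimodule `C` and a left `S`-module `N`; the left `R`-module
structure comes from the right action of `R` on `C`. -/
def BimodHom (_R : Type u) (S : Type w) [Ring S] (C : Type u) [AddCommGroup C] [Module S C]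
    (N : Type u) [AddCommGroup N] [Module S N] : Type u :=
  C →ₗ[S] N

instance (N : Type u) [AddCommGroup N] [Module S N] : AddCommGroup (BimodHom R S C N) :=
  inferInstanceAs (AddCommGroup (C →ₗ[S] N))

instance (N : Type u) [AddCommGroup N] [Module S N] : FunLike (BimodHom R S C N) C N :=
  inferInstanceAs (FunLike (C →ₗ[S] N) C N)

/-- The left action of `R` on `Hom_S(C, N)` is `(r • f) c = f (c r)`. -/
instance (N : Type u) [AddCommGroup N] [Module S N] : Module R (BimodHom R S C N) where
  smul r f := LinearMap.comp (show C →ₗ[S] N from f) (homothetyRight R S C r)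
  one_smul f := LinearMap.ext fun c => congrArg f (one_smul Rᵐᵒᵖ c)
  mul_smul r s f := LinearMap.ext fun c =>
    congrArg f (mul_smul (MulOpposite.op s) (MulOpposite.op r) c)
  smul_zero _ := rfl
  smul_add _ _ _ := rfl
  add_smul r s f := LinearMap.ext fun c =>
    (congrArg f (add_smul (MulOpposite.op r) (MulOpposite.op s) c)).trans
      (map_add (show C →ₗ[S] N from f) _ _)
  zero_smul f := LinearMap.ext fun c =>
    (congrArg f (zero_smul Rᵐᵒᵖ c)).trans (map_zero (show C →ₗ[S] N from f))

@[simp]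
theorem BimodHom.smul_apply (N : Type u) [AddCommGroup N] [Module S N] (r : R)
    (f : BimodHom R S C N) (c : C) : (r • f) c = f (MulOpposite.op r • c) := rfl

/-- The `R`-linear map `Hom_S(C, g) : Hom_S(C, N) → Hom_S(C, N')`, `f ↦ g ∘ f`. -/
def BimodHom.map {N N' : Type u} [AddCommGroup N] [Module S N] [AddCommGroup N'] [Module S N']
    (g : N →ₗ[S] N') : BimodHom R S C N →ₗ[R] BimodHom R S C N' where
  toFun f := LinearMap.comp g (show C →ₗ[S] N from f)
  map_add' f f' := LinearMap.comp_add (show C →ₗ[S] N from f) (show C →ₗ[S] N from f') g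
  map_smul' _ _ := rfl

/-- The functor `Hom_S(C, -)` from left `S`-modules to left `R`-modules. -/
def homFunctor : ModuleCat.{u} S ⥤ ModuleCat.{u} R where
  obj N := ModuleCat.of R (BimodHom R S C N)
  map g := ModuleCat.ofHom (BimodHom.map R S C g.hom)
  map_id _ := rfl
  map_comp _ _ := rfl

/-- The natural evaluation map `μ_M : M → Hom_S(C, C ⊗_R M)`, `m ↦ (c ↦ c ⊗ m)`. -/
def evalMu (M : Type u) [AddCommGroup M] [Module R M] :
    M →ₗ[R] BimodHom R S C (BalTensor R S C M) where
  toFun m :=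
    { toFun := fun c => BalTensor.tmul R S c m
      map_add' := fun c c' => by simp [BalTensor.tmul, TensorProduct.add_tmul]
      map_smul' := fun s c => by
        simp only [BalTensor.tmul, RingHom.id_apply, ← map_smul, TensorProduct.smul_tmul'] }
  map_add' m m' := LinearMap.ext fun c => by
    change (balanceRel R S C M).mkQ _ = (balanceRel R S C M).mkQ _ + (balanceRel R S C M).mkQ _
    rw [TensorProduct.tmul_add, map_add]
  map_smul' r m := LinearMap.ext fun c => (BalTensor.smul_tmul R S C r c m).symm

/-- The natural evaluation map `ν_N : C ⊗_R Hom_S(C, N) → N`, `c ⊗ f ↦ f c`. -/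
def evalNu (N : Type u) [AddCommGroup N] [Module S N] :
    BalTensor R S C (BimodHom R S C N) →ₗ[S] N :=
  Submodule.liftQ _
    (TensorProduct.AlgebraTensorModule.lift (R := ℤ) (A := S) (M := C) (N := BimodHom R S C N)
      (P := N)
      { toFun := fun c =>
          (AddMonoidHom.mk' (fun f : BimodHom R S C N => f c) fun _ _ => rfl).toIntLinearMap
        map_add' := fun c c' => LinearMap.ext fun f => map_add (show C →ₗ[S] N from f) c c'
        map_smul' := fun s c => LinearMap.ext fun f => map_smul (show C →ₗ[S] N from f) s c })
    (by
      refine Submodule.span_le.2 ?_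
      rintro _ ⟨c, r, f, rfl⟩
      rw [SetLike.mem_coe, LinearMap.mem_ker, map_sub, AlgebraTensorModule.lift_tmul,
        AlgebraTensorModule.lift_tmul, sub_eq_zero]
      rfl)

@[simp]
theorem evalNu_tmul (N : Type u) [AddCommGroup N] [Module S N] (c : C) (f : BimodHom R S C N) :
    evalNu R S C N (BalTensor.tmul R S c f) = f c := by
  rfl

end BimoduleHom

section Homological

/-- `Tor_i^R(N, M)` for a right `R`-module `N` and a left `R`-module `M`: the `i`-th left derived
functor of `N ⊗_R -`, an abelian group. -/
noncomputable def Tor (R : Type u) [Ring R] (N : Type u) [AddCommGroup N] [Module Rᵐᵒᵖ N]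
    (M : ModuleCat.{u} R) (i : ℕ) : ModuleCat.{u} ℤ :=
  ((tensorFunctor R ℤ N).leftDerived i).obj M

/-- `M` is super finitely presented: it admits a degreewise finite projective resolution. -/
def IsSuperFinitelyPresented {R : Type u} [Ring R] (M : ModuleCat.{u} R) : Prop :=
  ∃ P : ProjectiveResolution M, ∀ i, Module.Finite R (P.complex.X i)

/-- The weak injective dimension of a left `S`-module: the infimum of the `n` such that
`Ext^{n+1}_S(F, M) = 0` for all super finitely presented left `S`-modules `F`. -/
noncomputable def weakInjectiveDim {S : Type u} [Ring S] (M : ModuleCat.{u} S) : ℕ∞ :=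
  ⨅ (n : ℕ) (_ : ∀ F : ModuleCat.{u} S, IsSuperFinitelyPresented F →
    Subsingleton (Abelian.Ext F M (n + 1))), (n : ℕ∞)

/-- The weak flat dimension of a left `R`-module: the infimum of the `n` such that
`Tor_{n+1}^R(F, M) = 0` for all super finitely presented right `R`-modules `F`. -/
noncomputable def weakFlatDim {R : Type u} [Ring R] (M : ModuleCat.{u} R) : ℕ∞ :=
  ⨅ (n : ℕ) (_ : ∀ F : ModuleCat.{u} Rᵐᵒᵖ, IsSuperFinitelyPresented F →
    Subsingleton (Tor R F M (n + 1))), (n : ℕ∞)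

/-- The class `WI(S)` of weak injective left `S`-modules. -/
def WI (S : Type u) [Ring S] : ObjectProperty (ModuleCat.{u} S) := fun M =>
  ∀ F : ModuleCat.{u} S, IsSuperFinitelyPresented F → Subsingleton (Abelian.Ext F M 1)

/-- The class `WF(R)` of weak flat left `R`-modules. -/
def WF (R : Type u) [Ring R] : ObjectProperty (ModuleCat.{u} R) := fun M =>
  ∀ F : ModuleCat.{u} Rᵐᵒᵖ, IsSuperFinitelyPresented F → Subsingleton (Tor R F M 1)

/-- The class `WI(S)_{≤ n}` of left `S`-modules of weak injective dimension at most `n`. -/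
def WILE (S : Type u) [Ring S] (n : ℕ) : ObjectProperty (ModuleCat.{u} S) := fun M =>
  weakInjectiveDim M ≤ n

/-- The class `WF(R)_{≤ n}` of left `R`-modules of weak flat dimension at most `n`. -/
def WFLE (R : Type u) [Ring R] (n : ℕ) : ObjectProperty (ModuleCat.{u} R) := fun M =>
  weakFlatDim M ≤ n

/-- There is an exact sequence `0 → X n → ⋯ → X 1 → X 0 → M → 0` with all `X i` in `P`
(written as an infinite exact sequence with `X i = 0` for `i > n`). -/
def HasResolutionLE {A : Type u} [Ring A] (P : ObjectProperty (ModuleCat.{u} A)) (n : ℕ)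
    (M : ModuleCat.{u} A) : Prop :=
  ∃ (X : ℕ → ModuleCat.{u} A) (d : ∀ i, X (i + 1) ⟶ X i) (ε : X 0 ⟶ M),
    Function.Surjective ε ∧ Function.Exact (d 0) ε ∧
      (∀ i, Function.Exact (d (i + 1)) (d i)) ∧
      (∀ i ≤ n, P (X i)) ∧ ∀ i, n < i → Subsingleton (X i)

/-- There is an exact sequence `0 → M → X 0 → X 1 → ⋯ → X n → 0` with all `X i` in `P`
(written as an infinite exact sequence with `X i = 0` for `i > n`). -/
def HasCoresolutionLE {A : Type u} [Ring A] (P : ObjectProperty (ModuleCat.{u} A)) (n : ℕ)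
    (M : ModuleCat.{u} A) : Prop :=
  ∃ (X : ℕ → ModuleCat.{u} A) (d : ∀ i, X i ⟶ X (i + 1)) (η : M ⟶ X 0),
    Function.Injective η ∧ Function.Exact η (d 0) ∧
      (∀ i, Function.Exact (d i) (d (i + 1))) ∧
      (∀ i ≤ n, P (X i)) ∧ ∀ i, n < i → Subsingleton (X i)

end Homological

section Semidualizing

variable (R S : Type u) [Ring R] [Ring S]
variable (C : Type u) [AddCommGroup C] [Module S C] [Module Rᵐᵒᵖ C] [SMulCommClass S Rᵐᵒᵖ C]

/-- The `(S, R)`-bimodule `C` is semidualizing. -/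
structure IsSemidualizing : Prop where
  a1 : IsSuperFinitelyPresented (ModuleCat.of S C)
  a2 : IsSuperFinitelyPresented (ModuleCat.of Rᵐᵒᵖ C)
  /-- the homothety map `S → Hom_{Rᵒᵖ}(C, C)`, `s ↦ (c ↦ s c)`, is an isomorphism -/
  b1 : Function.Bijective (homothetyLeft R S C)
  /-- the homothety map `R → Hom_S(C, C)`, `r ↦ (c ↦ c r)`, is an isomorphism -/
  b2 : Function.Bijective (homothetyRight R S C)
  c1 : ∀ i : ℕ, 1 ≤ i → Subsingleton (Abelian.Ext (ModuleCat.of S C) (ModuleCat.of S C) i)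
  c2 : ∀ i : ℕ, 1 ≤ i →
    Subsingleton (Abelian.Ext (ModuleCat.of Rᵐᵒᵖ C) (ModuleCat.of Rᵐᵒᵖ C) i)

/-- The `(S, R)`-bimodule `C` is faithfully semidualizing. -/
structure IsFaithfullySemidualizing : Prop extends IsSemidualizing R S C where
  faithful_left : ∀ N : ModuleCat.{u} S, Subsingleton (C →ₗ[S] N) → Subsingleton N
  faithful_right : ∀ M : ModuleCat.{u} Rᵐᵒᵖ, Subsingleton (C →ₗ[Rᵐᵒᵖ] M) → Subsingleton M

/-- The Auslander class `A_C(R)`. -/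
structure AuslanderClass (M : ModuleCat.{u} R) : Prop where
  a1 : ∀ i : ℕ, 1 ≤ i → Subsingleton (Tor R C M i)
  a2 : ∀ i : ℕ, 1 ≤ i →
    Subsingleton (Abelian.Ext (ModuleCat.of S C) ((tensorFunctor R S C).obj M) i)
  a3 : Function.Bijective (evalMu R S C M)

/-- The Bass class `B_C(S)`. -/
structure BassClass (N : ModuleCat.{u} S) : Prop where
  b1 : ∀ i : ℕ, 1 ≤ i → Subsingleton (Abelian.Ext (ModuleCat.of S C) N i)
  b2 : ∀ i : ℕ, 1 ≤ i → Subsingleton (Tor R C ((homFunctor R S C).obj N) i)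
  b3 : Function.Bijective (evalNu R S C N)

/-- The class `WF_C(S)` of `C`-weak flat left `S`-modules: those of the form `C ⊗_R F` with `F`
a weak flat left `R`-module. -/
def WFC : ObjectProperty (ModuleCat.{u} S) := fun V =>
  ∃ F : ModuleCat.{u} R, WF R F ∧ Nonempty (V ≅ (tensorFunctor R S C).obj F)

/-- The class `WI_C(R)` of `C`-weak injective left `R`-modules: those of the form `Hom_S(C, I)`
with `I` a weak injective left `S`-module. -/
def WIC : ObjectProperty (ModuleCat.{u} R) := fun U =>
  ∃ I : ModuleCat.{u} S, WI S I ∧ Nonempty (U ≅ (homFunctor R S C).obj I)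

/-- The class `WF_C(S)_{≤ n}` of left `S`-modules of `C`-weak flat dimension at most `n`. -/
def WFCLE (n : ℕ) : ObjectProperty (ModuleCat.{u} S) := HasResolutionLE (WFC R S C) n

/-- The class `WI_C(R)_{≤ n}` of left `R`-modules of `C`-weak injective dimension at most `n`. -/
def WICLE (n : ℕ) : ObjectProperty (ModuleCat.{u} R) := HasCoresolutionLE (WIC R S C) n

/-- `C ⊗_R -` and `Hom_S(C, -)` restrict to functors between the full subcategories `P` and `Q`,
and these restrictions are mutually inverse equivalences of categories. -/
def RestrictToEquivalence (P : ObjectProperty (ModuleCat.{u} R))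
    (Q : ObjectProperty (ModuleCat.{u} S)) : Prop :=
  ∃ (hF : ∀ M : P.FullSubcategory, Q ((P.ι ⋙ tensorFunctor R S C).obj M))
    (hG : ∀ N : Q.FullSubcategory, P ((Q.ι ⋙ homFunctor R S C).obj N))
    (e : P.FullSubcategory ≌ Q.FullSubcategory),
    e.functor = Q.lift (P.ι ⋙ tensorFunctor R S C) hF ∧
      e.inverse = P.lift (Q.ι ⋙ homFunctor R S C) hG

end Semidualizing

end Foxby

/-! The equivalence between the Auslander and Bass classes is formal: `evalMu` and `evalNu` are the
unit and counit of the adjunction between the two functors, and the triangle identities carry the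
defining conditions of one class to those of the other. Any two subclasses exchanged by the functors
inherit the equivalence (`restrictToEquivalence`). What has to be shown is that weak flat modules
are Auslander, that weak injective modules are Bass, and that both facts survive finite resolutions.

For the first two, call `X` C-dualizable (`IsCDualizable`) if it is super finitely presented, has no
higher Ext into `C`, and has a super finitely presented dual `X* = Hom(X, C)`. If `0 → K → P → X →
0` is a suitable finitely generated projective presentation, then `K` is C-dualizable again and `0 →
X* → P* → K* → 0` is exact. For weak flat `M`, Tor vanishing against `K*` keeps this sequence exact
after tensoring with `M`. Comparison with `P`, where everything is explicit, makes `X* ⊗ M → Hom(X,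
C ⊗ M)` bijective and kills the higher Ext of `X` into `C ⊗ M`. Taking `X = C`, whose dual is `R` by
homothety, gives the Auslander conditions. Weak injective `N` are treated dually, with `X ⊗ Hom(C,
N) → Hom(X*, N)`.

For dimension at most `n`, induct along short exact sequences. Both classes are closed under
cokernels of monomorphisms and kernels of epimorphisms. Faithfulness is needed exactly for cokernels
in the Auslander class and kernels in the Bass class, where exactness of the image sequence does not
follow from Tor or Ext vanishing. -/

namespace Foxby

/-! ### Exactness of the tensor product over a noncommutative ring. -/

namespace BalTensor

variable {R : Type u} [Ring R] {S : Type w} [Ring S]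
variable {C : Type u} [AddCommGroup C] [Module S C] [Module Rᵐᵒᵖ C]
variable {M M' M'' : Type u} [AddCommGroup M] [Module R M] [AddCommGroup M'] [Module R M']
  [AddCommGroup M''] [Module R M'']

theorem tmul_add (c : C) (m m' : M) : tmul R S c (m + m') = tmul R S c m + tmul R S c m' := by
  unfold tmul
  rw [TensorProduct.tmul_add, map_add]

theorem add_tmul (c c' : C) (m : M) : tmul R S (c + c') m = tmul R S c m + tmul R S c' m := by
  unfold tmul
  rw [TensorProduct.add_tmul, map_add]

theorem smul_tmul_left (s : S) (c : C) (m : M) : tmul R S (s • c) m = s • tmul R S c m := by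
  unfold tmul
  rw [← TensorProduct.smul_tmul', map_smul]

@[simp]
theorem tmul_zero (c : C) : tmul R S c (0 : M) = 0 := by
  unfold tmul
  rw [TensorProduct.tmul_zero, map_zero]

@[simp]
theorem zero_tmul (m : M) : tmul R S (0 : C) m = 0 := by
  unfold tmul
  rw [TensorProduct.zero_tmul, map_zero]

@[elab_as_elim]
theorem induction_on {p : BalTensor R S C M → Prop} (t : BalTensor R S C M)
    (zero : p 0) (tmul : ∀ c m, p (tmul R S c m)) (add : ∀ x y, p x → p y → p (x + y)) : p t := by
  obtain ⟨t, rfl⟩ := Submodule.mkQ_surjective _ t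
  induction t with
  | zero => simpa using zero
  | tmul c m => exact tmul c m
  | add x y hx hy => simpa using add _ _ hx hy

/-- The additive map out of `C ⊗_R M` given by a balanced biadditive map. -/
def lift {A : Type*} [AddCommGroup A] (b : C →+ M →+ A)
    (hb : ∀ (r : R) c m, b (MulOpposite.op r • c) m = b c (r • m)) :
    BalTensor R ℤ C M →+ A :=
  (Submodule.liftQ (balanceRel R ℤ C M)
    (TensorProduct.lift
      ({ toFun := fun c => (b c).toIntLinearMap
         map_add' := fun c c' => by ext; simp
         map_smul' := fun s c => by ext; simp } : C →ₗ[ℤ] M →ₗ[ℤ] A))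
    (by
      refine Submodule.span_le.2 ?_
      rintro _ ⟨c, r, m, rfl⟩
      simp [hb])).toAddMonoidHom

@[simp]
theorem lift_tmul {A : Type*} [AddCommGroup A] (b : C →+ M →+ A)
    (hb : ∀ (r : R) c m, b (MulOpposite.op r • c) m = b c (r • m)) (c : C) (m : M) :
    lift b hb (tmul R ℤ c m) = b c m := rfl

section Right

theorem map_surjective {f : M →ₗ[R] M'} (hf : Function.Surjective f) :
    Function.Surjective (map R S C f) := by
  intro t
  induction t using induction_on with
  | zero => exact ⟨0, map_zero _⟩
  | tmul c m => obtain ⟨m, rfl⟩ := hf m; exact ⟨tmul R S c m, map_tmul ..⟩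
  | add x y hx hy =>
    obtain ⟨x, rfl⟩ := hx
    obtain ⟨y, rfl⟩ := hy
    exact ⟨x + y, map_add _ _ _⟩

theorem map_comp_apply (f : M →ₗ[R] M') (g : M' →ₗ[R] M'') (t : BalTensor R S C M) :
    map R S C g (map R S C f t) = map R S C (g ∘ₗ f) t := by
  induction t using induction_on with
  | zero => simp
  | tmul c m => simp
  | add x y hx hy => simp only [map_add, hx, hy]

theorem map_zero_apply (t : BalTensor R S C M) : map R S C (0 : M →ₗ[R] M') t = 0 := by
  induction t using induction_on with
  | zero => simp
  | tmul c m => simp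
  | add x y hx hy => simp only [map_add, hx, hy, add_zero]

/-- `C ⊗_R -` is right exact. -/
theorem map_exact {f : M →ₗ[R] M'} {g : M' →ₗ[R] M''} (h : Function.Exact f g)
    (hg : Function.Surjective g) : Function.Exact (map R ℤ C f) (map R ℤ C g) := by
  intro t
  constructor
  · intro ht
    -- A set-theoretic section `s` of `g` is enough: two lifts of the same element differ by the
    -- image of `f`, so `c ⊗ x ↦ [c ⊗ s x]` is additive and balanced modulo the range. The resulting
    -- `φ` sends `(C ⊗ g) t` to `[t]`, so the kernel of `C ⊗ g` lies in that range.
    let Q := BalTensor R ℤ C M' ⧸ LinearMap.range (map R ℤ C f)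
    have key : ∀ (c : C) (m m' : M'), g m = g m' →
        (Submodule.Quotient.mk (tmul R ℤ c m) : Q) = Submodule.Quotient.mk (tmul R ℤ c m') := by
      intro c m m' hm
      obtain ⟨x, hx⟩ := (h (m - m')).1 (by simp [hm])
      refine (Submodule.Quotient.eq _).2 ⟨tmul R ℤ c x, ?_⟩
      rw [map_tmul, hx, eq_sub_iff_add_eq, ← tmul_add, sub_add_cancel]
    let s := Function.surjInv hg
    have hs : ∀ x, g (s x) = x := Function.surjInv_eq hg
    let φ : BalTensor R ℤ C M'' →+ Q := lift
      (AddMonoidHom.mk' (fun c => AddMonoidHom.mk'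
        (fun m => (Submodule.Quotient.mk (tmul R ℤ c (s m)) : Q)) (fun a b => by
          rw [key c (s (a + b)) (s a + s b) (by simp [hs]), tmul_add, Submodule.Quotient.mk_add]))
        (fun a b => by ext m; simp [add_tmul]))
      (fun r c m => by
        simp only [AddMonoidHom.mk'_apply]
        rw [smul_tmul]
        exact key _ _ _ (by simp [hs]))
    have hφ : ∀ t, φ (map R ℤ C g t) = Submodule.Quotient.mk t := by
      intro t
      induction t using induction_on with
      | zero => simp
      | tmul c m => rw [map_tmul]; exact key _ _ _ (hs _)
      | add x y hx hy => simp only [map_add, hx, hy, Submodule.Quotient.mk_add]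
    have := hφ t
    rw [ht, map_zero] at this
    exact (Submodule.Quotient.mk_eq_zero _).1 this.symm
  · rintro ⟨t, rfl⟩
    rw [map_comp_apply, h.linearMap_comp_eq_zero, map_zero_apply]

end Right

section Left

variable {N N' N'' : Type u} [AddCommGroup N] [Module Rᵐᵒᵖ N] [AddCommGroup N'] [Module Rᵐᵒᵖ N']
  [AddCommGroup N''] [Module Rᵐᵒᵖ N'']

variable (M) in
/-- The additive map `f ⊗_R M : N ⊗_R M → N' ⊗_R M`. -/
def mapLeft (f : N →ₗ[Rᵐᵒᵖ] N') : BalTensor R ℤ N M →+ BalTensor R ℤ N' M :=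
  lift (AddMonoidHom.mk' (fun n => AddMonoidHom.mk' (fun m => tmul R ℤ (f n) m)
    (fun a b => tmul_add _ _ _)) (fun a b => by ext m; simp [add_tmul]))
    (fun r n m => by simp [smul_tmul])

@[simp]
theorem mapLeft_tmul (f : N →ₗ[Rᵐᵒᵖ] N') (n : N) (m : M) :
    mapLeft M f (tmul R ℤ n m) = tmul R ℤ (f n) m := rfl

theorem mapLeft_surjective {f : N →ₗ[Rᵐᵒᵖ] N'} (hf : Function.Surjective f) :
    Function.Surjective (mapLeft M f) := by
  intro t
  induction t using induction_on with
  | zero => exact ⟨0, map_zero _⟩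
  | tmul c m => obtain ⟨c, rfl⟩ := hf c; exact ⟨tmul R ℤ c m, rfl⟩
  | add x y hx hy =>
    obtain ⟨x, rfl⟩ := hx
    obtain ⟨y, rfl⟩ := hy
    exact ⟨x + y, map_add _ _ _⟩

theorem mapLeft_map (f : N →ₗ[Rᵐᵒᵖ] N') (g : M →ₗ[R] M') (t : BalTensor R ℤ N M) :
    mapLeft M' f (map R ℤ N g t) = map R ℤ N' g (mapLeft M f t) := by
  induction t using induction_on with
  | zero => simp
  | tmul c m => simp
  | add x y hx hy => simp only [map_add, hx, hy]

/-- `- ⊗_R M` is right exact. -/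
theorem mapLeft_exact {f : N →ₗ[Rᵐᵒᵖ] N'} {g : N' →ₗ[Rᵐᵒᵖ] N''} (h : Function.Exact f g)
    (hg : Function.Surjective g) : Function.Exact (mapLeft M f) (mapLeft M g) := by
  intro t
  constructor
  · intro ht
    let Q := BalTensor R ℤ N' M ⧸ (mapLeft M f).range
    have key : ∀ (m : M) (c c' : N'), g c = g c' →
        (QuotientAddGroup.mk (tmul R ℤ c m) : Q) = QuotientAddGroup.mk (tmul R ℤ c' m) := by
      intro m c c' hc
      obtain ⟨x, hx⟩ := (h (-c + c')).1 (by simp [hc])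
      refine QuotientAddGroup.eq.2 ⟨tmul R ℤ x m, ?_⟩
      rw [mapLeft_tmul, hx, add_tmul]
      congr 1
    let s := Function.surjInv hg
    have hs : ∀ x, g (s x) = x := Function.surjInv_eq hg
    let φ : BalTensor R ℤ N'' M →+ Q := lift
      (AddMonoidHom.mk' (fun c => AddMonoidHom.mk'
        (fun m => (QuotientAddGroup.mk (tmul R ℤ (s c) m) : Q)) (fun a b => by
          rw [tmul_add, QuotientAddGroup.mk_add]))
        (fun a b => by
          ext m
          simp only [AddMonoidHom.mk'_apply, AddMonoidHom.add_apply]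
          rw [key m (s (a + b)) (s a + s b) (by simp [hs]), add_tmul, QuotientAddGroup.mk_add]))
      (fun r c m => by
        simp only [AddMonoidHom.mk'_apply]
        rw [← smul_tmul]
        exact key _ _ _ (by simp [hs]))
    have hφ : ∀ t, φ (mapLeft M g t) = QuotientAddGroup.mk t := by
      intro t
      induction t using induction_on with
      | zero => simp
      | tmul c m => rw [mapLeft_tmul]; exact key _ _ _ (hs _)
      | add x y hx hy => simp only [map_add, hx, hy, QuotientAddGroup.mk_add]
    have := hφ t
    rw [ht, map_zero] at this
    exact (QuotientAddGroup.eq_zero_iff _).1 this.symm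
  · rintro ⟨t, rfl⟩
    induction t using induction_on with
    | zero => simp
    | tmul c m => simp [h.apply_apply_eq_zero]
    | add x y hx hy => simp only [map_add, hx, hy, add_zero]

/-- Tensoring with a projective left module preserves injections. -/
theorem mapLeft_injective [Module.Projective R M] {f : N →ₗ[Rᵐᵒᵖ] N'}
    (hf : Function.Injective f) : Function.Injective (mapLeft M f) := by
  obtain ⟨s, hs⟩ := (Module.projective_def' (R := R) (P := M)).1 inferInstance
  -- The splitting `s` of the free cover of `M` embeds `X ⊗ M` in a direct sum of copies of `X`,
  -- naturally in `X`; `Ψ` is a retraction for `X = N`. Injectivity can then be read off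
  -- coordinatewise.
  let Φ (X : Type u) [AddCommGroup X] [Module Rᵐᵒᵖ X] : BalTensor R ℤ X M →+ (M →₀ X) :=
    lift (AddMonoidHom.mk' (fun x => AddMonoidHom.mk'
      (fun m => (s m).mapRange (fun r => MulOpposite.op r • x) (by simp))
      (fun a b => by ext; simp [add_smul])) (fun a b => by ext; simp))
      (fun r x m => by ext; simp [mul_smul])
  let Ψ : (M →₀ N) →+ BalTensor R ℤ N M :=
    Finsupp.liftAddHom fun m => AddMonoidHom.mk' (fun x => tmul R ℤ x m) fun a b => add_tmul _ _ _
  have hΨ : ∀ t, Ψ (Φ N t) = t := by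
    intro t
    induction t using induction_on with
    | zero => simp
    | tmul x m =>
      have h1 : ∀ v : M →₀ R, Ψ (v.mapRange (fun r => MulOpposite.op r • x) (by simp)) =
          tmul R ℤ x (Finsupp.linearCombination R id v) := by
        intro v
        induction v using Finsupp.induction_linear with
        | zero => simp
        | add a b ha hb =>
          rw [Finsupp.mapRange_add (fun _ _ => by simp [add_smul]), map_add, ha, hb, map_add,
            tmul_add]
        | single a r =>
          rw [Finsupp.mapRange_single]
          simp [Ψ, smul_tmul]
      exact (h1 (s m)).trans (congrArg _ (LinearMap.congr_fun hs m))
    | add x y hx hy => simp only [map_add, hx, hy]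
  have hnat : ∀ t, Φ N' (mapLeft M f t) = (Φ N t).mapRange f (map_zero f) := by
    intro t
    induction t using induction_on with
    | zero => simp
    | tmul x m => ext; simp [Φ]
    | add x y hx hy => rw [map_add, map_add, hx, hy, map_add, Finsupp.mapRange_add (map_add f)]
  refine (injective_iff_map_eq_zero _).2 fun t ht => ?_
  have h0 : (Φ N t).mapRange f (map_zero f) = (0 : M →₀ N).mapRange f (map_zero f) := by
    rw [← hnat, ht, map_zero, Finsupp.mapRange_zero]
  rw [← hΨ t, Finsupp.mapRange_injective f (map_zero f) hf h0, map_zero]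

/-- Tensoring with a projective right module preserves injections. -/
theorem map_injective [Module.Projective Rᵐᵒᵖ N] {f : M →ₗ[R] M'}
    (hf : Function.Injective f) : Function.Injective (map R ℤ N f) := by
  obtain ⟨s, hs⟩ := (Module.projective_def' (R := Rᵐᵒᵖ) (P := N)).1 inferInstance
  let Φ (X : Type u) [AddCommGroup X] [Module R X] : BalTensor R ℤ N X →+ (N →₀ X) :=
    lift (AddMonoidHom.mk' (fun n => AddMonoidHom.mk'
      (fun x => (s n).mapRange (fun r => r.unop • x) (by simp))
      (fun a b => by ext; simp)) (fun a b => by ext; simp [add_smul]))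
      (fun r n x => by ext; simp [mul_smul])
  let Ψ : (N →₀ M) →+ BalTensor R ℤ N M :=
    Finsupp.liftAddHom fun n => AddMonoidHom.mk' (fun x => tmul R ℤ n x) fun a b => tmul_add _ _ _
  have hΨ : ∀ t, Ψ (Φ M t) = t := by
    intro t
    induction t using induction_on with
    | zero => simp
    | tmul n x =>
      have h1 : ∀ v : N →₀ Rᵐᵒᵖ, Ψ (v.mapRange (fun r => r.unop • x) (by simp)) =
          tmul R ℤ (Finsupp.linearCombination Rᵐᵒᵖ id v) x := by
        intro v
        induction v using Finsupp.induction_linear with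
        | zero => simp
        | add a b ha hb =>
          rw [Finsupp.mapRange_add (fun _ _ => by simp [add_smul]), map_add, ha, hb, map_add,
            add_tmul]
        | single a r =>
          rw [Finsupp.mapRange_single]
          simp [Ψ, ← smul_tmul]
      exact (h1 (s n)).trans (congrArg (fun y => tmul R ℤ y x) (LinearMap.congr_fun hs n))
    | add x y hx hy => simp only [map_add, hx, hy]
  have hnat : ∀ t, Φ M' (map R ℤ N f t) = (Φ M t).mapRange f (map_zero f) := by
    intro t
    induction t using induction_on with
    | zero => simp
    | tmul x m => ext; simp [Φ]
    | add x y hx hy => rw [map_add, map_add, hx, hy, map_add, Finsupp.mapRange_add (map_add f)]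
  refine (injective_iff_map_eq_zero _).2 fun t ht => ?_
  have h0 : (Φ M t).mapRange f (map_zero f) = (0 : N →₀ M).mapRange f (map_zero f) := by
    rw [← hnat, ht, map_zero, Finsupp.mapRange_zero]
  rw [← hΨ t, Finsupp.mapRange_injective f (map_zero f) hf h0, map_zero]

end Left

/-! ### Independence of the tensor product from the left structure. -/

section Comparison

variable [SMulCommClass S Rᵐᵒᵖ C]

variable (R S C M) in
/-- The tensor product `C ⊗_R M` does not depend on the left structure of `C`. -/
theorem balanceRel_toAddSubgroup :
    (balanceRel R S C M).toAddSubgroup = (balanceRel R ℤ C M).toAddSubgroup := by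
  -- The two actions on `C` commute, so `s` carries balancing relations to balancing relations and
  -- their `ℤ`-span is already `S`-stable.
  have hsmul : ∀ (s : S) (x : C ⊗[ℤ] M), x ∈ balanceRel R ℤ C M → s • x ∈ balanceRel R ℤ C M := by
    intro s x hx
    induction hx using Submodule.span_induction with
    | mem x h =>
      obtain ⟨c, r, m, rfl⟩ := h
      refine Submodule.subset_span ⟨s • c, r, m, ?_⟩
      rw [smul_sub, TensorProduct.smul_tmul', TensorProduct.smul_tmul', smul_comm]
    | zero => simp
    | add x y _ _ hx hy => rw [smul_add]; exact add_mem hx hy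
    | smul a x _ hx => rw [smul_comm]; exact Submodule.smul_mem _ _ hx
  refine le_antisymm (fun x hx => ?_) (fun x hx => ?_)
  · change x ∈ balanceRel R ℤ C M
    change x ∈ balanceRel R S C M at hx
    induction hx using Submodule.span_induction with
    | mem x h => exact Submodule.subset_span h
    | zero => exact zero_mem _
    | add x y _ _ hx hy => exact add_mem hx hy
    | smul a x _ hx => exact hsmul _ _ hx
  · change x ∈ balanceRel R S C M
    change x ∈ balanceRel R ℤ C M at hx
    induction hx using Submodule.span_induction with
    | mem x h => exact Submodule.subset_span h
    | zero => exact zero_mem _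
    | add x y _ _ hx hy => exact add_mem hx hy
    | smul a x _ hx => exact zsmul_mem hx a

variable (R S C M) in
/-- The comparison between the two versions of `C ⊗_R M`. -/
def equivInt : BalTensor R S C M ≃+ BalTensor R ℤ C M :=
  QuotientAddGroup.quotientAddEquivOfEq (balanceRel_toAddSubgroup R S C M)

@[simp]
theorem equivInt_tmul (c : C) (m : M) : equivInt R S C M (tmul R S c m) = tmul R ℤ c m := rfl

theorem equivInt_map (f : M →ₗ[R] M') (t : BalTensor R S C M) :
    equivInt R S C M' (map R S C f t) = map R ℤ C f (equivInt R S C M t) := by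
  induction t using induction_on with
  | zero => simp
  | tmul c m => simp
  | add x y hx hy => simp only [map_add, hx, hy]

/-- `Tor` is computed with the `ℤ`-version of the tensor product, the Foxby functor with the
`S`-version; this passes between them. -/
theorem map_injective_iff (f : M →ₗ[R] M') :
    Function.Injective (map R S C f) ↔ Function.Injective (map R ℤ C f) := by
  have h : ∀ t, map R ℤ C f t = equivInt R S C M' (map R S C f ((equivInt R S C M).symm t)) :=
    fun t => by simp [equivInt_map]
  have h' : (map R ℤ C f : _ → _) = equivInt R S C M' ∘ map R S C f ∘ (equivInt R S C M).symm :=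
    funext h
  rw [h', (equivInt R S C M').injective.of_comp_iff]
  exact ((equivInt R S C M).symm.toEquiv.injective_comp _).symm

theorem map_exact' {f : M →ₗ[R] M'} {g : M' →ₗ[R] M''} (h : Function.Exact f g)
    (hg : Function.Surjective g) : Function.Exact (map R S C f) (map R S C g) := by
  intro t
  have := map_exact (C := C) h hg (equivInt R S C M' t)
  rw [← equivInt_map, map_eq_zero_iff _ (equivInt R S C M'').injective] at this
  rw [this]
  constructor
  · rintro ⟨x, hx⟩
    obtain ⟨x, rfl⟩ := (equivInt R S C M).surjective x
    rw [← equivInt_map] at hx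
    exact ⟨x, (equivInt R S C M').injective hx⟩
  · rintro ⟨x, rfl⟩
    exact ⟨equivInt R S C M x, (equivInt_map _ _).symm⟩

end Comparison

end BalTensor

/-! ### Projective resolutions as exact sequences of modules. -/

section Sequences

variable {A : Type u} [Ring A] {M : ModuleCat.{u} A}

theorem moduleCat_comp_eq_zero {X Y Z : ModuleCat.{u} A} {f : X ⟶ Y} {g : Y ⟶ Z}
    (h : Function.Exact f g) : f ≫ g = 0 := by
  ext x
  exact h.apply_apply_eq_zero x

theorem chainComplexOf_d (X : ℕ → ModuleCat.{u} A) (d : ∀ i, X (i + 1) ⟶ X i)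
    (w : ∀ i, d (i + 1) ≫ d i = 0) (i : ℕ) : (ChainComplex.of X d w).d (i + 1) i = d i :=
  ChainComplex.of_d X d i

/-- An exact sequence `⋯ → X 1 → X 0 → M → 0` of projective modules, as a projective
resolution. -/
noncomputable def resolutionOfSequence (X : ℕ → ModuleCat.{u} A) (d : ∀ i, X (i + 1) ⟶ X i)
    (ε : X 0 ⟶ M) (hX : ∀ i, Projective (X i)) (hε : Function.Surjective ε)
    (h0 : Function.Exact (d 0) ε) (hd : ∀ i, Function.Exact (d (i + 1)) (d i)) :
    ProjectiveResolution M where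
  complex := ChainComplex.of X d fun i => moduleCat_comp_eq_zero (hd i)
  projective := hX
  π := (ChainComplex.toSingle₀Equiv _ _).symm ⟨ε, by
    refine (congrArg (· ≫ ε) (chainComplexOf_d X d _ 0)).trans ?_
    exact moduleCat_comp_eq_zero h0⟩
  quasiIso := ⟨fun n => by
    cases n with
    | zero =>
      rw [ChainComplex.quasiIsoAt₀_iff, ShortComplex.quasiIso_iff_of_zeros']
      · have w : ∀ i, d (i + 1) ≫ d i = 0 := fun i => moduleCat_comp_eq_zero (hd i)
        have w0 : (ChainComplex.of X d w).d 1 0 ≫ ε = 0 := by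
          refine (congrArg (· ≫ ε) (chainComplexOf_d X d _ 0)).trans ?_
          exact moduleCat_comp_eq_zero h0
        have h1 : (((ChainComplex.of X d w).toSingle₀Equiv M).symm ⟨ε, w0⟩).f 0 = ε :=
          ChainComplex.toSingle₀Equiv_symm_apply_f_zero _ _
        have h2 := chainComplexOf_d X d w 0
        refine ⟨(ShortComplex.ShortExact.moduleCat_exact_iff_function_exact _).2 ?_,
          (ModuleCat.epi_iff_surjective _).2 ?_⟩
        · change Function.Exact ((ChainComplex.of X d w).d 1 0)
            ((((ChainComplex.of X d w).toSingle₀Equiv M).symm ⟨ε, w0⟩).f 0)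
          rw [h1, h2]
          exact h0
        · change Function.Surjective ((((ChainComplex.of X d w).toSingle₀Equiv M).symm ⟨ε, w0⟩).f 0)
          rw [h1]
          exact hε
      all_goals rfl
    | succ n =>
      rw [quasiIsoAt_iff_exactAt' _ _ (ChainComplex.exactAt_succ_single_obj _ _),
        HomologicalComplex.exactAt_iff' _ (n + 2) (n + 1) n (by simp) (by simp)]
      refine (ShortComplex.ShortExact.moduleCat_exact_iff_function_exact _).2 ?_
      have w : ∀ i, d (i + 1) ≫ d i = 0 := fun i => moduleCat_comp_eq_zero (hd i)
      have h1 := chainComplexOf_d X d w (n + 1)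
      have h2 := chainComplexOf_d X d w n
      change Function.Exact ((ChainComplex.of X d w).d (n + 2) (n + 1))
        ((ChainComplex.of X d w).d (n + 1) n)
      rw [h1, h2]
      exact hd n⟩

theorem exists_projective_sequence (P : ProjectiveResolution M) :
    Function.Surjective (P.π.f 0) ∧ Function.Exact (P.complex.d 1 0) (P.π.f 0) ∧
      ∀ i, Function.Exact (P.complex.d (i + 2) (i + 1)) (P.complex.d (i + 1) i) :=
  ⟨(ModuleCat.epi_iff_surjective _).1 inferInstance,
    (ShortComplex.ShortExact.moduleCat_exact_iff_function_exact _).1 P.exact₀,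
    fun i => (ShortComplex.ShortExact.moduleCat_exact_iff_function_exact _).1 (P.exact_succ i)⟩

/-- The sequence `Q, X 0, X 1, …`. -/
def consObj (Q : ModuleCat.{u} A) (X : ℕ → ModuleCat.{u} A) : ℕ → ModuleCat.{u} A
  | 0 => Q
  | n + 1 => X n

/-- The maps `⋯ → X 1 → X 0 → Q` of a sequence lengthened to the right. -/
def consMap {Q : ModuleCat.{u} A} {X : ℕ → ModuleCat.{u} A} (q : X 0 ⟶ Q)
    (d : ∀ i, X (i + 1) ⟶ X i) : ∀ i, consObj Q X (i + 1) ⟶ consObj Q X i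
  | 0 => q
  | n + 1 => d n

end Sequences

/-! ### Vanishing of Tor as exactness, and shifting in the second variable. -/

section Tor

variable {R : Type u} [Ring R] (N : Type u) [AddCommGroup N] [Module Rᵐᵒᵖ N]

theorem subsingleton_tor_succ_iff {M : ModuleCat.{u} R} (P : ProjectiveResolution M) (i : ℕ) :
    Subsingleton (Tor R N M (i + 1)) ↔
      Function.Exact (BalTensor.map R ℤ N (P.complex.d (i + 2) (i + 1)).hom)
        (BalTensor.map R ℤ N (P.complex.d (i + 1) i).hom) := by
  have e := (P.isoLeftDerivedObj (tensorFunctor R ℤ N) (i + 1))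
  rw [← ModuleCat.isZero_iff_subsingleton]
  unfold Tor
  rw [e.isZero_iff]
  change Limits.IsZero (HomologicalComplex.homology _ _) ↔ _
  rw [← HomologicalComplex.exactAt_iff_isZero_homology,
    HomologicalComplex.exactAt_iff' _ (i + 2) (i + 1) i (by simp) (by simp)]
  exact ShortComplex.ShortExact.moduleCat_exact_iff_function_exact _

theorem subsingleton_tor_succ_iff_of_sequence {M : ModuleCat.{u} R} (X : ℕ → ModuleCat.{u} R)
    (d : ∀ i, X (i + 1) ⟶ X i)
    (ε : X 0 ⟶ M) (hX : ∀ i, Projective (X i)) (hε : Function.Surjective ε)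
    (h0 : Function.Exact (d 0) ε) (hd : ∀ i, Function.Exact (d (i + 1)) (d i)) (i : ℕ) :
    Subsingleton (Tor R N M (i + 1)) ↔
      Function.Exact (BalTensor.map R ℤ N (d (i + 1)).hom)
        (BalTensor.map R ℤ N (d i).hom) := by
  have w : ∀ i, d (i + 1) ≫ d i = 0 := fun i => moduleCat_comp_eq_zero (hd i)
  rw [subsingleton_tor_succ_iff N (resolutionOfSequence X d ε hX hε h0 hd)]
  change Function.Exact (BalTensor.map R ℤ N ((ChainComplex.of X d w).d (i + 1 + 1) (i + 1)).hom)
    (BalTensor.map R ℤ N ((ChainComplex.of X d w).d (i + 1) i).hom) ↔ _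
  rw [chainComplexOf_d X d w (i + 1), chainComplexOf_d X d w i]

/-- `b` identifies `Z` with the cokernel of `a`. Applied to a resolution, this turns exactness in
degree one into injectivity of `N ⊗ K → N ⊗ Q`. -/
theorem exact_comp_injective_iff {X Y Z W : Type*} [AddGroup X] [AddGroup Y] [AddGroup Z]
    [AddGroup W] {a : X →+ Y} {b : Y →+ Z} {c : Z →+ W} (hab : Function.Exact a b)
    (hb : Function.Surjective b) : Function.Exact a (c.comp b) ↔ Function.Injective c := by
  constructor
  · intro h
    refine (injective_iff_map_eq_zero c).2 fun z hz => ?_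
    obtain ⟨y, rfl⟩ := hb z
    exact (hab y).2 ((h y).1 hz)
  · intro h y
    rw [← hab y]
    exact map_eq_zero_iff c h

/-- Dimension shifting for `Tor` along a projective presentation of the second variable. -/
theorem tor_shift_right {K Q M : Type u} [AddCommGroup K] [Module R K] [AddCommGroup Q]
    [Module R Q] [AddCommGroup M] [Module R M] [Module.Projective R Q] {j : K →ₗ[R] Q}
    {p : Q →ₗ[R] M} (hj : Function.Injective j) (hjp : Function.Exact j p)
    (hp : Function.Surjective p) :
    (Subsingleton (Tor R N (ModuleCat.of R M) 1) ↔ Function.Injective (BalTensor.map R ℤ N j)) ∧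
      ∀ i, Subsingleton (Tor R N (ModuleCat.of R M) (i + 2)) ↔
        Subsingleton (Tor R N (ModuleCat.of R K) (i + 1)) := by
  obtain ⟨P⟩ := HasProjectiveResolution.out (Z := ModuleCat.of R K)
  obtain ⟨hε, h0, hd⟩ := exists_projective_sequence P
  -- Prepending `Q` to a resolution of `K` gives a resolution of `M` that agrees with the old one,
  -- shifted by one, from degree one on.
  let X : ℕ → ModuleCat.{u} R := consObj (ModuleCat.of R Q) P.complex.X
  let ε : P.complex.X 0 ⟶ ModuleCat.of R K := P.π.f 0
  let d : ∀ i, X (i + 1) ⟶ X i :=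
    consMap (Q := ModuleCat.of R Q) (ε ≫ ModuleCat.ofHom j) fun i => P.complex.d (i + 1) i
  have hX : ∀ i, Projective (X i) := by
    rintro (_ | i)
    · exact (ModuleCat.of R Q).projective_of_categoryTheory_projective
    · exact P.projective i
  have h0' : Function.Exact (d 0) (ModuleCat.ofHom p) := by
    intro x
    refine (hjp x).trans ⟨?_, ?_⟩
    · rintro ⟨y, rfl⟩
      obtain ⟨z, rfl⟩ := hε y
      exact ⟨z, rfl⟩
    · rintro ⟨z, rfl⟩
      exact ⟨ε z, rfl⟩
  have hd' : ∀ i, Function.Exact (d (i + 1)) (d i) := by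
    rintro (_ | i)
    · intro x
      refine Iff.trans ?_ (h0 x)
      exact map_eq_zero_iff j hj
    · exact hd i
  have key := subsingleton_tor_succ_iff_of_sequence N X d (ModuleCat.ofHom p) hX hp h0' hd'
  constructor
  · rw [key 0]
    have e1 : Function.Exact (BalTensor.map R ℤ N (P.complex.d 1 0).hom)
      (BalTensor.map R ℤ N ε.hom) := BalTensor.map_exact h0 hε
    have e2 : Function.Surjective (BalTensor.map R ℤ N ε.hom) := BalTensor.map_surjective hε
    refine Iff.trans ?_ (exact_comp_injective_iff
      (a := (BalTensor.map R ℤ N (P.complex.d 1 0).hom).toAddMonoidHom)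
      (b := (BalTensor.map R ℤ N ε.hom).toAddMonoidHom)
      (c := (BalTensor.map R ℤ N j).toAddMonoidHom) e1 e2)
    have : (BalTensor.map R ℤ N (d 0).hom : _ → _) =
        (BalTensor.map R ℤ N j).toAddMonoidHom.comp (BalTensor.map R ℤ N ε.hom).toAddMonoidHom := by
      funext t
      exact (BalTensor.map_comp_apply ε.hom j t).symm
    rw [← this]
    rfl
  · intro i
    rw [key (i + 1), subsingleton_tor_succ_iff N P i]
    rfl

end Tor

/-! ### Balance of Tor vanishing and pieces of its long exact sequences. -/

section TorSequences

variable {R : Type u} [Ring R]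
variable {K P N : Type u} [AddCommGroup K] [Module Rᵐᵒᵖ K] [AddCommGroup P] [Module Rᵐᵒᵖ P]
  [AddCommGroup N] [Module Rᵐᵒᵖ N]
variable {M' M M'' : Type u} [AddCommGroup M'] [Module R M'] [AddCommGroup M] [Module R M]
  [AddCommGroup M''] [Module R M'']
variable {f : K →ₗ[Rᵐᵒᵖ] P} {g : P →ₗ[Rᵐᵒᵖ] N} {a : M' →ₗ[R] M} {b : M →ₗ[R] M''}

open BalTensor

/-- Snake-type chase in the grid `{K, P, N} ⊗ {M', M, M''}`; projectivity of `P` makes the row `P ⊗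
M' → P ⊗ M` injective. -/
theorem map_injective_of_mapLeft_injective [Module.Projective Rᵐᵒᵖ P]
    (hfg : Function.Exact f g) (hg : Function.Surjective g) (ha : Function.Injective a)
    (hab : Function.Exact a b) (hb : Function.Surjective b)
    (h : Function.Injective (mapLeft M'' f)) : Function.Injective (map R ℤ N a) := by
  refine (injective_iff_map_eq_zero _).2 fun t ht => ?_
  obtain ⟨t, rfl⟩ := mapLeft_surjective hg t
  rw [← mapLeft_map] at ht
  obtain ⟨x, hx⟩ := (mapLeft_exact hfg hg _).1 ht
  have h1 : mapLeft M'' f (map R ℤ K b x) = 0 := by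
    rw [mapLeft_map, hx]
    exact (map_exact hab hb).apply_apply_eq_zero t
  obtain ⟨v, rfl⟩ := (map_exact hab hb _).1 ((map_eq_zero_iff _ h).1 h1)
  rw [mapLeft_map] at hx
  rw [← map_injective ha hx]
  exact (mapLeft_exact hfg hg).apply_apply_eq_zero v

/-- The same chase with the roles of rows and columns exchanged; injectivity of `K ⊗ M → P ⊗ M`
replaces projectivity. -/
theorem mapLeft_injective_of_map_injective
    (hfg : Function.Exact f g) (hg : Function.Surjective g)
    (hab : Function.Exact a b) (hb : Function.Surjective b)
    (h : Function.Injective (mapLeft M f)) (h' : Function.Injective (map R ℤ N a)) :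
    Function.Injective (mapLeft M'' f) := by
  refine (injective_iff_map_eq_zero _).2 fun t ht => ?_
  obtain ⟨t, rfl⟩ := map_surjective hb t
  rw [mapLeft_map] at ht
  obtain ⟨x, hx⟩ := (map_exact hab hb _).1 ht
  have h1 : map R ℤ N a (mapLeft M' g x) = 0 := by
    rw [← mapLeft_map, hx]
    exact (mapLeft_exact hfg hg).apply_apply_eq_zero t
  obtain ⟨v, rfl⟩ := (mapLeft_exact hfg hg _).1 ((map_eq_zero_iff _ h').1 h1)
  rw [← mapLeft_map] at hx
  rw [← h hx]
  exact (map_exact hab hb).apply_apply_eq_zero v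

theorem exists_projective_presentation (A : Type u) [Ring A] (M : Type u) [AddCommGroup M]
    [Module A M] : ∃ (K P : Type u) (_ : AddCommGroup K) (_ : Module A K) (_ : AddCommGroup P)
      (_ : Module A P) (_ : Module.Projective A P) (f : K →ₗ[A] P) (g : P →ₗ[A] M),
      Function.Injective f ∧ Function.Exact f g ∧ Function.Surjective g :=
  ⟨LinearMap.ker (Finsupp.linearCombination A (id : M → M)), M →₀ A, inferInstance, inferInstance,
    inferInstance, inferInstance, inferInstance, Submodule.subtype _,
    Finsupp.linearCombination A (id : M → M), Submodule.subtype_injective _,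
    LinearMap.exact_subtype_ker_map _,
    Finsupp.linearCombination_surjective A Function.surjective_id⟩

/-- Balance of `Tor` in degree one: the two chases, run against a projective presentation of `M`,
translate the injectivity criterion in the second variable into the one in the first. -/
theorem tor_one_iff_left [Module.Projective Rᵐᵒᵖ P] (hf : Function.Injective f)
    (hfg : Function.Exact f g) (hg : Function.Surjective g) :
    Subsingleton (Tor R N (ModuleCat.of R M) 1) ↔ Function.Injective (mapLeft M f) := by
  obtain ⟨L, Q, _, _, _, _, _, j, p, hj, hjp, hp⟩ := exists_projective_presentation R M
  rw [(tor_shift_right N hj hjp hp).1]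
  exact ⟨fun h => mapLeft_injective_of_map_injective hfg hg hjp hp (mapLeft_injective hf) h,
    fun h => map_injective_of_mapLeft_injective hfg hg hj hjp hp h⟩

/-- Dimension shifting for `Tor` along a projective presentation of the first variable. -/
theorem tor_shift_left [Module.Projective Rᵐᵒᵖ P] (hf : Function.Injective f)
    (hfg : Function.Exact f g) (hg : Function.Surjective g) (i : ℕ) :
    Subsingleton (Tor R N (ModuleCat.of R M) (i + 2)) ↔
      Subsingleton (Tor R K (ModuleCat.of R M) (i + 1)) := by
  induction i generalizing M with
  | zero =>
    obtain ⟨L, Q, _, _, _, _, _, j, p, hj, hjp, hp⟩ := exists_projective_presentation R M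
    rw [(tor_shift_right N hj hjp hp).2, tor_one_iff_left hf hfg hg, zero_add,
      (tor_shift_right K hj hjp hp).1]
    -- Both composites of the square from `K ⊗ L` to `P ⊗ Q` end in an injection, as `P` and `Q` are
    -- projective, so the initial maps are injective together.
    have e : (mapLeft Q f : _ → _) ∘ map R ℤ K j = map R ℤ P j ∘ mapLeft L f :=
      funext fun t => mapLeft_map f j t
    rw [← (map_injective (N := P) hj).of_comp_iff, ← e, (mapLeft_injective hf).of_comp_iff]
  | succ i ih =>
    obtain ⟨L, Q, _, _, _, _, _, j, p, hj, hjp, hp⟩ := exists_projective_presentation R M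
    rw [(tor_shift_right N hj hjp hp).2, (tor_shift_right K hj hjp hp).2, ih]

/-- This and the next three lemmas are fragments of the long exact Tor sequence in the second
variable. Chases against a projective presentation of `N` replace connecting maps, and shifting in
`N` reduces high degrees to the lowest one. -/
theorem map_injective_of_tor_one (ha : Function.Injective a) (hab : Function.Exact a b)
    (hb : Function.Surjective b) (h : Subsingleton (Tor R N (ModuleCat.of R M'') 1)) :
    Function.Injective (map R ℤ N a) := by
  obtain ⟨K, P, _, _, _, _, _, f, g, hf, hfg, hg⟩ := exists_projective_presentation Rᵐᵒᵖ N
  exact map_injective_of_mapLeft_injective hfg hg ha hab hb ((tor_one_iff_left hf hfg hg).1 h)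

theorem tor_one_of_map_injective (hab : Function.Exact a b)
    (hb : Function.Surjective b) (h : Subsingleton (Tor R N (ModuleCat.of R M) 1))
    (h' : Function.Injective (map R ℤ N a)) :
    Subsingleton (Tor R N (ModuleCat.of R M'') 1) := by
  obtain ⟨K, P, _, _, _, _, _, f, g, hf, hfg, hg⟩ := exists_projective_presentation Rᵐᵒᵖ N
  rw [tor_one_iff_left hf hfg hg] at h ⊢
  exact mapLeft_injective_of_map_injective hfg hg hab hb h h'

theorem tor_succ_succ_of_shortExact (ha : Function.Injective a) (hab : Function.Exact a b)
    (hb : Function.Surjective b) (i : ℕ) (h' : Subsingleton (Tor R N (ModuleCat.of R M') (i + 1)))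
    (h : Subsingleton (Tor R N (ModuleCat.of R M) (i + 2))) :
    Subsingleton (Tor R N (ModuleCat.of R M'') (i + 2)) := by
  induction i generalizing N with
  | zero =>
    obtain ⟨K, P, _, _, _, _, _, f, g, hf, hfg, hg⟩ := exists_projective_presentation Rᵐᵒᵖ N
    rw [tor_shift_left hf hfg hg] at h ⊢
    rw [zero_add, tor_one_iff_left hf hfg hg] at h'
    refine tor_one_of_map_injective hab hb h ?_
    have e : (mapLeft M f : _ → _) ∘ map R ℤ K a = map R ℤ P a ∘ mapLeft M' f :=
      funext fun t => mapLeft_map f a t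
    refine Function.Injective.of_comp (f := mapLeft M f) ?_
    rw [e]
    exact (map_injective ha).comp h'
  | succ i ih =>
    obtain ⟨K, P, _, _, _, _, _, f, g, hf, hfg, hg⟩ := exists_projective_presentation Rᵐᵒᵖ N
    rw [tor_shift_left hf hfg hg] at h h' ⊢
    exact ih h' h

theorem tor_succ_of_shortExact (ha : Function.Injective a) (hab : Function.Exact a b)
    (hb : Function.Surjective b) (i : ℕ) (h : Subsingleton (Tor R N (ModuleCat.of R M) (i + 1)))
    (h'' : Subsingleton (Tor R N (ModuleCat.of R M'') (i + 2))) :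
    Subsingleton (Tor R N (ModuleCat.of R M') (i + 1)) := by
  induction i generalizing N with
  | zero =>
    obtain ⟨K, P, _, _, _, _, _, f, g, hf, hfg, hg⟩ := exists_projective_presentation Rᵐᵒᵖ N
    rw [tor_shift_left hf hfg hg] at h''
    rw [zero_add, tor_one_iff_left hf hfg hg] at h ⊢
    have h1 := map_injective_of_tor_one ha hab hb h''
    have e : (mapLeft M f : _ → _) ∘ map R ℤ K a = map R ℤ P a ∘ mapLeft M' f :=
      funext fun t => mapLeft_map f a t
    refine Function.Injective.of_comp (f := map R ℤ P a) ?_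
    rw [← e]
    exact h.comp h1
  | succ i ih =>
    obtain ⟨K, P, _, _, _, _, _, f, g, hf, hfg, hg⟩ := exists_projective_presentation Rᵐᵒᵖ N
    rw [tor_shift_left hf hfg hg] at h h'' ⊢
    exact ih h h''

theorem tor_projective (M : ModuleCat.{u} R) [Projective M] (N : Type u) [AddCommGroup N]
    [Module Rᵐᵒᵖ N] (i : ℕ) : Subsingleton (Tor R N M (i + 1)) :=
  ModuleCat.isZero_iff_subsingleton.1
    (Functor.isZero_leftDerived_obj_projective_succ (tensorFunctor R ℤ N) i M)

theorem subsingleton_tor_iff_of_iso (N : Type u) [AddCommGroup N] [Module Rᵐᵒᵖ N]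
    {M M' : ModuleCat.{u} R} (e : M ≅ M') (i : ℕ) :
    Subsingleton (Tor R N M i) ↔ Subsingleton (Tor R N M' i) := by
  rw [← ModuleCat.isZero_iff_subsingleton, ← ModuleCat.isZero_iff_subsingleton]
  exact (((tensorFunctor R ℤ N).leftDerived i).mapIso e).isZero_iff

end TorSequences

/-! ### Pieces of the long exact sequences of Ext. -/

section ExtSequences

variable {A : Type u} [Ring A]
variable {K P N : Type u} [AddCommGroup K] [Module A K] [AddCommGroup P] [Module A P]
  [AddCommGroup N] [Module A N]
variable {f : K →ₗ[A] P} {g : P →ₗ[A] N}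

open Abelian

theorem shortExact_of_function (hf : Function.Injective f) (hfg : Function.Exact f g)
    (hg : Function.Surjective g) :
    (ShortComplex.mk (ModuleCat.ofHom f) (ModuleCat.ofHom g)
      (moduleCat_comp_eq_zero hfg)).ShortExact where
  exact := (ShortComplex.ShortExact.moduleCat_exact_iff_function_exact _).2 hfg
  mono_f := (ModuleCat.mono_iff_injective _).2 hf
  epi_g := (ModuleCat.epi_iff_surjective _).2 hg

section First

variable (Y : ModuleCat.{u} A)

theorem hom_extend_of_ext_one (hf : Function.Injective f) (hfg : Function.Exact f g)
    (hg : Function.Surjective g) (h : Subsingleton (Ext (ModuleCat.of A N) Y 1))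
    (φ : K →ₗ[A] Y) : ∃ ψ : P →ₗ[A] Y, ψ ∘ₗ f = φ := by
  have hS := shortExact_of_function hf hfg hg
  obtain ⟨x, hx⟩ := Ext.contravariant_sequence_exact₁ hS (Y := Y)
    (Ext.mk₀ (ModuleCat.ofHom φ : ModuleCat.of A K ⟶ Y)) (add_zero 1) (Subsingleton.elim _ _)
  obtain ⟨ψ, rfl⟩ := (Ext.mk₀_bijective _ _).2 x
  rw [Ext.mk₀_comp_mk₀] at hx
  exact ⟨ψ.hom, congrArg ModuleCat.Hom.hom ((Ext.mk₀_bijective _ _).1 hx)⟩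

/-- As `P` is projective, every class in `Ext¹(N, Y)` is the extension class composed with some `φ :
K → Y`; it dies as soon as `φ` extends to `P`. -/
theorem ext_one_of_hom_extend [Module.Projective A P] (hf : Function.Injective f)
    (hfg : Function.Exact f g) (hg : Function.Surjective g)
    (h : ∀ φ : K →ₗ[A] Y, ∃ ψ : P →ₗ[A] Y, ψ ∘ₗ f = φ) :
    Subsingleton (Ext (ModuleCat.of A N) Y 1) := by
  have hS := shortExact_of_function hf hfg hg
  have : Projective (ModuleCat.of A P) :=
    (ModuleCat.of A P).projective_of_categoryTheory_projective
  refine subsingleton_of_forall_eq 0 fun x => ?_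
  obtain ⟨z, rfl⟩ := Ext.contravariant_sequence_exact₃ hS (Y := Y) x
    (Ext.eq_zero_of_projective _) (add_zero 1)
  obtain ⟨φ, rfl⟩ := (Ext.mk₀_bijective _ _).2 z
  obtain ⟨ψ, hψ⟩ := h φ.hom
  have : φ = ModuleCat.ofHom f ≫ (ModuleCat.ofHom ψ : ModuleCat.of A P ⟶ Y) := by
    ext1
    exact hψ.symm
  rw [this, ← Ext.mk₀_comp_mk₀]
  exact hS.extClass_comp_assoc _

theorem ext_shift_left [Module.Projective A P] (hf : Function.Injective f)
    (hfg : Function.Exact f g) (hg : Function.Surjective g) (i : ℕ) :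
    Subsingleton (Ext (ModuleCat.of A N) Y (i + 2)) ↔
      Subsingleton (Ext (ModuleCat.of A K) Y (i + 1)) := by
  have hS := shortExact_of_function hf hfg hg
  have : Projective (ModuleCat.of A P) :=
    (ModuleCat.of A P).projective_of_categoryTheory_projective
  constructor
  · refine fun h => subsingleton_of_forall_eq 0 fun x => ?_
    obtain ⟨x, rfl⟩ := Ext.contravariant_sequence_exact₁ hS (Y := Y) (n₁ := i + 2) x
      (by lia) (Subsingleton.elim _ _)
    rw [Ext.eq_zero_of_projective x, Ext.comp_zero]
  · refine fun h => subsingleton_of_forall_eq 0 fun x => ?_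
    obtain ⟨x, rfl⟩ := Ext.contravariant_sequence_exact₃ hS (Y := Y) x
      (Ext.eq_zero_of_projective _) (n₀ := i + 1) (by lia)
    rw [Subsingleton.elim x 0, Ext.comp_zero]

end First

section Second

variable (X : ModuleCat.{u} A)

theorem hom_lift_of_ext_one (hf : Function.Injective f) (hfg : Function.Exact f g)
    (hg : Function.Surjective g) (h : Subsingleton (Ext X (ModuleCat.of A K) 1))
    (φ : X →ₗ[A] N) : ∃ ψ : X →ₗ[A] P, g ∘ₗ ψ = φ := by
  have hS := shortExact_of_function hf hfg hg
  obtain ⟨x, hx⟩ := Ext.covariant_sequence_exact₃ X hS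
    (Ext.mk₀ (ModuleCat.ofHom φ : X ⟶ ModuleCat.of A N)) (zero_add 1) (Subsingleton.elim _ _)
  obtain ⟨ψ, rfl⟩ := (Ext.mk₀_bijective _ _).2 x
  rw [Ext.mk₀_comp_mk₀] at hx
  exact ⟨ψ.hom, congrArg ModuleCat.Hom.hom ((Ext.mk₀_bijective _ _).1 hx)⟩

/-- As `Ext¹(X, P) = 0`, every class in `Ext¹(X, K)` is the image of some `φ : X → N` under the
connecting map, and a lift of `φ` to `P` kills it. -/
theorem ext_one_of_hom_lift (hf : Function.Injective f) (hfg : Function.Exact f g)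
    (hg : Function.Surjective g) (h : Subsingleton (Ext X (ModuleCat.of A P) 1))
    (hl : ∀ φ : X →ₗ[A] N, ∃ ψ : X →ₗ[A] P, g ∘ₗ ψ = φ) :
    Subsingleton (Ext X (ModuleCat.of A K) 1) := by
  have hS := shortExact_of_function hf hfg hg
  refine subsingleton_of_forall_eq 0 fun x => ?_
  obtain ⟨z, rfl⟩ := Ext.covariant_sequence_exact₁ X hS x (Subsingleton.elim _ _) (zero_add 1)
  obtain ⟨φ, rfl⟩ := (Ext.mk₀_bijective _ _).2 z
  obtain ⟨ψ, hψ⟩ := hl φ.hom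
  have : φ = (ModuleCat.ofHom ψ : X ⟶ ModuleCat.of A P) ≫ ModuleCat.ofHom g := by
    ext1
    exact hψ.symm
  rw [this, ← Ext.mk₀_comp_mk₀, Ext.comp_assoc (a₂₃ := 1) _ _ _ (by lia) (by lia) (by lia)]
  have h0 : (Ext.mk₀ (ModuleCat.ofHom g)).comp hS.extClass (zero_add 1) = 0 := hS.comp_extClass
  rw [h0, Ext.comp_zero]

theorem ext_of_shortExact (hf : Function.Injective f) (hfg : Function.Exact f g)
    (hg : Function.Surjective g) (i : ℕ) (h : Subsingleton (Ext X (ModuleCat.of A P) i))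
    (h' : Subsingleton (Ext X (ModuleCat.of A K) (i + 1))) :
    Subsingleton (Ext X (ModuleCat.of A N) i) := by
  have hS := shortExact_of_function hf hfg hg
  refine subsingleton_of_forall_eq 0 fun x => ?_
  obtain ⟨z, rfl⟩ := Ext.covariant_sequence_exact₃ X hS x (n₁ := i + 1) rfl (Subsingleton.elim _ _)
  rw [Subsingleton.elim z 0, Ext.zero_comp]

theorem ext_succ_of_shortExact (hf : Function.Injective f) (hfg : Function.Exact f g)
    (hg : Function.Surjective g) (i : ℕ) (h : Subsingleton (Ext X (ModuleCat.of A P) (i + 1)))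
    (h' : Subsingleton (Ext X (ModuleCat.of A N) i)) :
    Subsingleton (Ext X (ModuleCat.of A K) (i + 1)) := by
  have hS := shortExact_of_function hf hfg hg
  refine subsingleton_of_forall_eq 0 fun x => ?_
  obtain ⟨z, rfl⟩ := Ext.covariant_sequence_exact₁ X hS x (Subsingleton.elim _ _) (n₀ := i) rfl
  rw [Subsingleton.elim z 0, Ext.zero_comp]

theorem subsingleton_ext_of_iso {Y Y' : ModuleCat.{u} A} (e : Y ≅ Y') (i : ℕ)
    (h : Subsingleton (Ext X Y i)) : Subsingleton (Ext X Y' i) := by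
  refine subsingleton_of_forall_eq 0 fun x => ?_
  rw [← x.comp_mk₀_id, ← e.inv_hom_id, ← Ext.mk₀_comp_mk₀,
    ← Ext.comp_assoc (a₁₂ := i) _ _ _ (by lia) (by lia) (by lia),
    Subsingleton.elim (x.comp (Ext.mk₀ e.inv) (add_zero i)) 0, Ext.zero_comp]

end Second

end ExtSequences

/-! ### Permanence properties of super finitely presented modules. -/

section SuperFinitelyPresented

variable {A : Type u} [Ring A]

/-- A class of modules in which every module is a quotient of a finitely generated projective
module by a submodule that belongs to the class. -/
def IsSyzygyClosed (𝒳 : ObjectProperty (ModuleCat.{u} A)) : Prop :=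
  ∀ M, 𝒳 M → ∃ (P : ModuleCat.{u} A) (g : P →ₗ[A] M), Module.Projective A P ∧ Module.Finite A P ∧
    Function.Surjective g ∧ 𝒳 (ModuleCat.of A (LinearMap.ker g))

/-- Super finitely presented modules form the largest class closed under syzygies. -/
theorem IsSyzygyClosed.isSuperFinitelyPresented {𝒳 : ObjectProperty (ModuleCat.{u} A)}
    (h : IsSyzygyClosed 𝒳) {M : ModuleCat.{u} A} (hM : 𝒳 M) : IsSuperFinitelyPresented M := by
  choose P g hP hP' hg hK using h
  -- `K n` is the `n`-th iterated chosen syzygy of `M`; splicing the covers `ε` with the kernel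
  -- inclusions gives the resolution.
  let K : ℕ → {N : ModuleCat.{u} A // 𝒳 N} :=
    fun n => n.rec ⟨M, hM⟩ fun _ N => ⟨ModuleCat.of A (LinearMap.ker (g N.1 N.2)), hK N.1 N.2⟩
  let X : ℕ → ModuleCat.{u} A := fun n => P (K n).1 (K n).2
  let ε : ∀ n, X n →ₗ[A] (K n).1 := fun n => g (K n).1 (K n).2
  let d : ∀ i, X (i + 1) ⟶ X i := fun i =>
    ModuleCat.ofHom ((LinearMap.ker (ε i)).subtype ∘ₗ ε (i + 1))
  have hε : ∀ i, Function.Surjective (ε i) := fun i => hg _ _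
  have h0 : ∀ i, Function.Exact (d i) (ε i) := by
    intro i x
    constructor
    · intro hx
      obtain ⟨y, hy⟩ := hε (i + 1) ⟨x, hx⟩
      exact ⟨y, congrArg Subtype.val hy⟩
    · rintro ⟨y, rfl⟩
      exact (ε (i + 1) y).2
  refine ⟨resolutionOfSequence X d (ModuleCat.ofHom (ε 0)) (fun i => ?_) (hε 0) (h0 0)
    (fun i x => ?_), fun i => hP' _ _⟩
  · have := hP (K i).1 (K i).2
    exact (X i).projective_of_categoryTheory_projective
  · refine Iff.trans ?_ (h0 (i + 1) x)
    exact Submodule.coe_eq_zero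

theorem isSyzygyClosed_isSuperFinitelyPresented :
    IsSyzygyClosed (IsSuperFinitelyPresented (R := A)) := by
  rintro M ⟨P, hP⟩
  obtain ⟨hε, h0, hd⟩ := exists_projective_sequence P
  let ε : P.complex.X 0 →ₗ[A] M := (P.π.f 0).hom
  refine ⟨P.complex.X 0, ε, inferInstance, hP 0, hε, ?_⟩
  let q : P.complex.X 1 →ₗ[A] LinearMap.ker ε :=
    LinearMap.codRestrict _ (P.complex.d 1 0).hom fun x => h0.apply_apply_eq_zero x
  refine ⟨resolutionOfSequence (fun i => P.complex.X (i + 1)) (fun i => P.complex.d (i + 2) (i + 1))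
    (ModuleCat.ofHom q) (fun i => P.projective _) ?_ ?_ (fun i => hd (i + 1)), fun i => hP (i + 1)⟩
  · rintro ⟨x, hx⟩
    obtain ⟨y, hy⟩ := (h0 x).1 hx
    exact ⟨y, Subtype.ext hy⟩
  · intro x
    refine Iff.trans ?_ (hd 0 x)
    exact Submodule.coe_eq_zero.symm

namespace IsSuperFinitelyPresented

theorem of_ker {M : ModuleCat.{u} A} (P : ModuleCat.{u} A) (g : P →ₗ[A] M)
    [Module.Projective A P] [Module.Finite A P] (hg : Function.Surjective g)
    (h : IsSuperFinitelyPresented (ModuleCat.of A (LinearMap.ker g))) :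
    IsSuperFinitelyPresented M := by
  refine IsSyzygyClosed.isSuperFinitelyPresented
    (𝒳 := fun N => ∃ (P : ModuleCat.{u} A) (g : P →ₗ[A] N), Module.Projective A P ∧
      Module.Finite A P ∧ Function.Surjective g ∧
        IsSuperFinitelyPresented (ModuleCat.of A (LinearMap.ker g))) ?_
    ⟨P, g, inferInstance, inferInstance, hg, h⟩
  rintro N ⟨P, g, h1, h2, h3, h4⟩
  exact ⟨P, g, h1, h2, h3, isSyzygyClosed_isSuperFinitelyPresented _ h4⟩

theorem of_equiv {M N : Type u} [AddCommGroup M] [Module A M] [AddCommGroup N] [Module A N]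
    (e : M ≃ₗ[A] N) (h : IsSuperFinitelyPresented (ModuleCat.of A M)) :
    IsSuperFinitelyPresented (ModuleCat.of A N) := by
  obtain ⟨P, g, _, _, h3, h4⟩ := isSyzygyClosed_isSuperFinitelyPresented _ h
  refine of_ker P (e.toLinearMap ∘ₗ g) (e.surjective.comp h3) ?_
  rwa [LinearEquiv.ker_comp]

theorem of_projective (P : Type u) [AddCommGroup P] [Module A P] [Module.Projective A P]
    [Module.Finite A P] : IsSuperFinitelyPresented (ModuleCat.of A P) := by
  refine IsSyzygyClosed.isSuperFinitelyPresented
    (𝒳 := fun N => Module.Projective A N ∧ Module.Finite A N) ?_ ⟨inferInstance, inferInstance⟩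
  rintro N ⟨h1, h2⟩
  have : Subsingleton (LinearMap.ker (LinearMap.id : N →ₗ[A] N)) := by
    rw [LinearMap.ker_id]
    infer_instance
  exact ⟨N, LinearMap.id, h1, h2, Function.surjective_id,
    inferInstanceAs (Module.Projective A (LinearMap.ker (LinearMap.id : N →ₗ[A] N))),
    inferInstanceAs (Module.Finite A (LinearMap.ker (LinearMap.id : N →ₗ[A] N)))⟩

variable {X Y Z : Type u} [AddCommGroup X] [Module A X] [AddCommGroup Y] [Module A Y]
  [AddCommGroup Z] [Module A Z] {a : X →ₗ[A] Y} {b : Y →ₗ[A] Z}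

/-- Horseshoe argument: the kernel of the cover `P × Q → Y` is an extension of `ker q` by `ker p`,
so the class of all such extensions is closed under syzygies. -/
theorem extension (ha : Function.Injective a) (hab : Function.Exact a b)
    (hb : Function.Surjective b) (hX : IsSuperFinitelyPresented (ModuleCat.of A X))
    (hZ : IsSuperFinitelyPresented (ModuleCat.of A Z)) :
    IsSuperFinitelyPresented (ModuleCat.of A Y) := by
  refine IsSyzygyClosed.isSuperFinitelyPresented
    (𝒳 := fun Y => ∃ (X Z : ModuleCat.{u} A) (a : X →ₗ[A] Y) (b : Y →ₗ[A] Z),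
      Function.Injective a ∧ Function.Exact a b ∧ Function.Surjective b ∧
      IsSuperFinitelyPresented X ∧ IsSuperFinitelyPresented Z) ?_
    ⟨ModuleCat.of A X, ModuleCat.of A Z, a, b, ha, hab, hb, hX, hZ⟩
  clear hX hZ ha hb hab
  rintro Y ⟨X, Z, a, b, ha, hab, hb, hX, hZ⟩
  obtain ⟨P, p, _, _, hp, hP⟩ := isSyzygyClosed_isSuperFinitelyPresented _ hX
  obtain ⟨Q, q, _, _, hq, hQ⟩ := isSyzygyClosed_isSuperFinitelyPresented _ hZ
  obtain ⟨s, hs⟩ := Module.projective_lifting_property b q hb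
  let G : (P × Q) →ₗ[A] Y := (a ∘ₗ p).coprod s
  have hs' : ∀ y, b (s y) = q y := LinearMap.congr_fun hs
  have hG : ∀ x y, G (x, y) = a (p x) + s y := fun x y => by simp [G]
  have hbG : ∀ x y, b (G (x, y)) = q y := fun x y => by
    rw [hG, map_add, hab.apply_apply_eq_zero, zero_add, hs']
  let α : LinearMap.ker p →ₗ[A] LinearMap.ker G :=
    LinearMap.codRestrict _ (LinearMap.inl A P Q ∘ₗ (LinearMap.ker p).subtype) fun x => by
      have : p x.1 = 0 := x.2
      simp [G, this]
  let β : LinearMap.ker G →ₗ[A] LinearMap.ker q :=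
    LinearMap.codRestrict _ (LinearMap.snd A P Q ∘ₗ (LinearMap.ker G).subtype) fun x => by
      obtain ⟨⟨x, y⟩, h⟩ := x
      have h : G (x, y) = 0 := h
      have := hbG x y
      rw [h, map_zero] at this
      exact this.symm
  refine ⟨ModuleCat.of A (P × Q), G, inferInstanceAs (Module.Projective A (P × Q)),
    inferInstanceAs (Module.Finite A (P × Q)), ?_, ModuleCat.of A (LinearMap.ker p),
    ModuleCat.of A (LinearMap.ker q), α, β, ?_, ?_, ?_, hP, hQ⟩
  · intro y
    obtain ⟨z, hz⟩ := hq (b y)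
    obtain ⟨x, hx⟩ := (hab (y - s z)).1 (by rw [map_sub, hs', hz, sub_self])
    obtain ⟨x, rfl⟩ := hp x
    exact ⟨(x, z), by rw [hG, hx, sub_add_cancel]⟩
  · intro x y h
    exact Subtype.ext (congrArg (fun t => t.1.1) h)
  · rintro ⟨⟨x, y⟩, h⟩
    constructor
    · intro hy
      have hy : y = 0 := congrArg Subtype.val hy
      subst hy
      have h : G (x, 0) = 0 := h
      rw [hG, map_zero, add_zero, map_eq_zero_iff a ha] at h
      exact ⟨⟨x, h⟩, rfl⟩
    · rintro ⟨z, hz⟩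
      rw [← hz]
      rfl
  · rintro ⟨y, hy⟩
    have hy : q y = 0 := hy
    obtain ⟨x, hx⟩ := (hab (s y)).1 (by rw [hs', hy])
    obtain ⟨x, rfl⟩ := hp x
    refine ⟨⟨(-x, y), ?_⟩, rfl⟩
    rw [LinearMap.mem_ker, hG, map_neg, map_neg, hx, neg_add_cancel]

/-- For a cover `p : P → Y`, the kernel of the composite `P → Z` is an extension of `ker b ≅ X` by
`ker p`. -/
theorem cokernel (ha : Function.Injective a) (hab : Function.Exact a b)
    (hb : Function.Surjective b) (hX : IsSuperFinitelyPresented (ModuleCat.of A X))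
    (hY : IsSuperFinitelyPresented (ModuleCat.of A Y)) :
    IsSuperFinitelyPresented (ModuleCat.of A Z) := by
  obtain ⟨P, p, _, _, hp, hP⟩ := isSyzygyClosed_isSuperFinitelyPresented _ hY
  refine of_ker P (b ∘ₗ p) (hb.comp hp) ?_
  let α : LinearMap.ker p →ₗ[A] LinearMap.ker (b ∘ₗ p) :=
    Submodule.inclusion fun x hx => by
      have hx : p x = 0 := hx
      simp [hx]
  let β : LinearMap.ker (b ∘ₗ p) →ₗ[A] LinearMap.ker b :=
    LinearMap.codRestrict _ (p ∘ₗ (LinearMap.ker (b ∘ₗ p)).subtype) fun x => x.2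
  have e : X ≃ₗ[A] LinearMap.ker b :=
    (LinearEquiv.ofInjective a ha).trans (LinearEquiv.ofEq _ _ hab.linearMap_ker_eq.symm)
  refine extension (a := α) (b := β) (Submodule.inclusion_injective _) ?_ ?_ hP (of_equiv e hX)
  · rintro ⟨x, hx⟩
    constructor
    · intro h
      exact ⟨⟨x, congrArg Subtype.val h⟩, rfl⟩
    · rintro ⟨z, hz⟩
      rw [← hz]
      exact Subtype.ext z.2
  · rintro ⟨y, hy⟩
    obtain ⟨x, rfl⟩ := hp y
    exact ⟨⟨x, hy⟩, rfl⟩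

/-- The kernel of the composite cover `P → Y → X` need not visibly be super finitely presented.
Adding the summand `X` makes it an extension of `Y` by `ker g`, so the kernel is again a retract of
a super finitely presented module, and the class of retracts is closed under syzygies. -/
theorem retract {i : X →ₗ[A] Y} {p : Y →ₗ[A] X} (h : p ∘ₗ i = LinearMap.id)
    (hY : IsSuperFinitelyPresented (ModuleCat.of A Y)) :
    IsSuperFinitelyPresented (ModuleCat.of A X) := by
  refine IsSyzygyClosed.isSuperFinitelyPresented
    (𝒳 := fun X => ∃ (Y : ModuleCat.{u} A) (i : X →ₗ[A] Y) (p : Y →ₗ[A] X),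
      p ∘ₗ i = LinearMap.id ∧ IsSuperFinitelyPresented Y) ?_
    ⟨ModuleCat.of A Y, i, p, h, hY⟩
  clear hY h
  rintro X ⟨Y, i, p, h, hY⟩
  have hpi : ∀ x, p (i x) = x := LinearMap.congr_fun h
  obtain ⟨P, g, h1, h2, hg, hK⟩ := isSyzygyClosed_isSuperFinitelyPresented _ hY
  have hp : Function.Surjective p := fun x => ⟨i x, hpi x⟩
  refine ⟨P, p ∘ₗ g, h1, h2, hp.comp hg, ModuleCat.of A (LinearMap.ker (p ∘ₗ g) × X),
    LinearMap.inl _ _ _, LinearMap.fst _ _ _, rfl, ?_⟩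
  have hle : LinearMap.ker g ≤ LinearMap.ker (p ∘ₗ g) := fun x hx => by
    have hx : g x = 0 := hx
    simp [hx]
  let β : (LinearMap.ker (p ∘ₗ g) × X) →ₗ[A] Y :=
    (g ∘ₗ (LinearMap.ker (p ∘ₗ g)).subtype).coprod i
  have hβ : ∀ x y, β (x, y) = g x.1 + i y := fun x y => by simp [β]
  refine extension (a := LinearMap.inl A _ X ∘ₗ Submodule.inclusion hle) (b := β) ?_ ?_ ?_ hK hY
  · exact LinearMap.inl_injective.comp (Submodule.inclusion_injective _)
  · rintro ⟨⟨x, hx⟩, y⟩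
    have hx' : p (g x) = 0 := hx
    constructor
    · intro h
      rw [hβ] at h
      have hy := congrArg p h
      rw [map_add, hx', hpi, zero_add, map_zero] at hy
      subst hy
      rw [map_zero, add_zero] at h
      exact ⟨⟨x, h⟩, rfl⟩
    · rintro ⟨z, hz⟩
      rw [← hz]
      change β (Submodule.inclusion hle z, 0) = 0
      rw [hβ, map_zero, add_zero]
      exact z.2
  · intro y
    obtain ⟨x, hx⟩ := hg (y - i (p y))
    refine ⟨(⟨x, ?_⟩, p y), ?_⟩
    · change p (g x) = 0
      rw [hx, map_sub, hpi, sub_self]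
    · rw [hβ, hx, sub_add_cancel]

theorem prod (hX : IsSuperFinitelyPresented (ModuleCat.of A X))
    (hY : IsSuperFinitelyPresented (ModuleCat.of A Y)) :
    IsSuperFinitelyPresented (ModuleCat.of A (X × Y)) :=
  extension (a := LinearMap.inl A X Y) (b := LinearMap.snd A X Y) LinearMap.inl_injective
    Function.Exact.inl_snd LinearMap.snd_surjective hX hY

theorem pi (hX : IsSuperFinitelyPresented (ModuleCat.of A X)) (n : ℕ) :
    IsSuperFinitelyPresented (ModuleCat.of A (Fin n → X)) := by
  induction n with
  | zero =>
    have : Module.Projective A (Fin 0 → X) := inferInstance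
    exact of_projective _
  | succ n ih => exact of_equiv (Fin.consLinearEquiv A fun _ : Fin (n + 1) => X) (prod hX ih)

end IsSuperFinitelyPresented

end SuperFinitelyPresented

/-! ### Duality into `C` and C-dualizable modules. -/

section Duals

open Abelian

variable {A B : Type u} [Ring A] [Ring B]
variable {C : Type u} [AddCommGroup C] [Module A C] [Module B C] [SMulCommClass A B C]
variable {X Y Z : Type u} [AddCommGroup X] [Module A X] [AddCommGroup Y] [Module A Y]
  [AddCommGroup Z] [Module A Z]

variable (B C) in
/-- The `B`-linear map `Hom_A(Y, C) → Hom_A(X, C)` induced by an `A`-linear map `X → Y`. -/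
def dualMap (f : X →ₗ[A] Y) : (Y →ₗ[A] C) →ₗ[B] (X →ₗ[A] C) where
  toFun φ := φ ∘ₗ f
  map_add' _ _ := rfl
  map_smul' _ _ := rfl

@[simp]
theorem dualMap_apply (f : X →ₗ[A] Y) (φ : Y →ₗ[A] C) : dualMap B C f φ = φ ∘ₗ f := rfl

theorem dualMap_injective {g : Y →ₗ[A] Z} (hg : Function.Surjective g) :
    Function.Injective (dualMap B C g) := fun _ _ h =>
  (LinearMap.cancel_right hg).1 h

theorem exists_factor_of_exact {f : X →ₗ[A] Y} {g : Y →ₗ[A] Z} (h : Function.Exact f g)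
    (hg : Function.Surjective g) {W : Type*} [AddCommGroup W] [Module A W] (φ : Y →ₗ[A] W)
    (hφ : φ ∘ₗ f = 0) : ∃ ψ : Z →ₗ[A] W, ψ ∘ₗ g = φ := by
  have hle : LinearMap.ker g ≤ LinearMap.ker φ := by
    intro y hy
    obtain ⟨x, rfl⟩ := (h y).1 hy
    exact LinearMap.congr_fun hφ x
  refine ⟨(LinearMap.ker g).liftQ φ hle ∘ₗ (g.quotKerEquivOfSurjective hg).symm.toLinearMap, ?_⟩
  ext y
  have : (g.quotKerEquivOfSurjective hg).symm (g y) = (LinearMap.ker g).mkQ y := by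
    rw [LinearEquiv.symm_apply_eq]
    rfl
  simp [this]

theorem dualMap_exact {f : X →ₗ[A] Y} {g : Y →ₗ[A] Z} (h : Function.Exact f g)
    (hg : Function.Surjective g) : Function.Exact (dualMap B C g) (dualMap B C f) := by
  intro φ
  constructor
  · exact exists_factor_of_exact h hg φ
  · rintro ⟨ψ, rfl⟩
    ext x
    simp [h.apply_apply_eq_zero]

/-- The map `c ↦ (x ↦ φ(x) c)` from `C` to `Hom_A(X, C)`, for `φ : X → A`. -/
def coordMap (B C : Type u) [Ring B] [AddCommGroup C] [Module A C] [Module B C]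
    [SMulCommClass A B C] (φ : X →ₗ[A] A) : C →ₗ[B] (X →ₗ[A] C) where
  toFun c := LinearMap.toSpanSingleton A C c ∘ₗ φ
  map_add' c c' := by ext; simp
  map_smul' b c := by
    ext x
    exact smul_comm (φ x) b c

@[simp]
theorem coordMap_apply (φ : X →ₗ[A] A) (c : C) (x : X) : coordMap B C φ c x = φ x • c := rfl

theorem exists_dualBasis (A X : Type u) [Ring A] [AddCommGroup X] [Module A X]
    [Module.Projective A X] [Module.Finite A X] :
    ∃ (n : ℕ) (b : Fin n → X) (φ : Fin n → X →ₗ[A] A), ∀ x, ∑ j, φ j x • b j = x := by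
  obtain ⟨n, f, g, -, -, h⟩ := Module.Finite.exists_comp_eq_id_of_projective A X
  refine ⟨n, fun j => f (Pi.single j 1), fun j => LinearMap.proj j ∘ₗ g, fun x => ?_⟩
  have hx : f (g x) = x := LinearMap.congr_fun h x
  have hg : g x = ∑ j, g x j • Pi.single j (1 : A) := by
    ext i
    simp [Finset.sum_apply, Pi.single_apply]
  conv_rhs => rw [← hx, hg, map_sum]
  simp

theorem sum_coordMap {n : ℕ} {b : Fin n → X} {φ : Fin n → X →ₗ[A] A}
    (h : ∀ x, ∑ j, φ j x • b j = x) (f : X →ₗ[A] C) : ∑ j, coordMap B C (φ j) (f (b j)) = f := by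
  ext x
  conv_rhs => rw [← h x]
  simp

/-- A finite dual basis of `X` exhibits `Hom(X, C)` as a direct summand of a power of `C`. -/
theorem isSuperFinitelyPresented_dual (hC : IsSuperFinitelyPresented (ModuleCat.of B C))
    (X : Type u) [AddCommGroup X] [Module A X] [Module.Projective A X] [Module.Finite A X] :
    IsSuperFinitelyPresented (ModuleCat.of B (X →ₗ[A] C)) := by
  obtain ⟨n, b, φ, h⟩ := exists_dualBasis A X
  let i : (X →ₗ[A] C) →ₗ[B] (Fin n → C) :=
    { toFun := fun f j => f (b j)
      map_add' := fun _ _ => rfl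
      map_smul' := fun _ _ => rfl }
  let p : (Fin n → C) →ₗ[B] (X →ₗ[A] C) := ∑ j, coordMap B C (φ j) ∘ₗ LinearMap.proj j
  refine IsSuperFinitelyPresented.retract (i := i) (p := p) ?_ (hC.pi n)
  ext1 f
  simpa [p, i] using sum_coordMap (B := B) h f

variable (B C) in
/-- A super finitely presented module whose `C`-dual is super finitely presented and
computes the derived dual. -/
structure IsCDualizable (X : ModuleCat.{u} A) : Prop where
  sfp : IsSuperFinitelyPresented X
  ext : ∀ i, Subsingleton (Ext X (ModuleCat.of A C) (i + 1))
  sfp_dual : IsSuperFinitelyPresented (ModuleCat.of B (X →ₗ[A] C))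

theorem IsCDualizable.dualMap_surjective {X : ModuleCat.{u} A} (hX : IsCDualizable B C X)
    {f : Y →ₗ[A] Z} {g : Z →ₗ[A] X} (hf : Function.Injective f) (hfg : Function.Exact f g)
    (hg : Function.Surjective g) : Function.Surjective (dualMap B C f) :=
  hom_extend_of_ext_one (ModuleCat.of A C) hf hfg hg (hX.ext 0)

/-- This drives every induction on C-dualizable modules. Since `Ext¹(X, C) = 0`, the dual of the
syzygy is the cokernel of the injection `X* → P*`, whose two terms are super finitely presented. -/
theorem IsCDualizable.exists_syzygy (hC : IsSuperFinitelyPresented (ModuleCat.of B C))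
    {X : ModuleCat.{u} A} (hX : IsCDualizable B C X) :
    ∃ (P : ModuleCat.{u} A) (g : P →ₗ[A] X), Module.Projective A P ∧ Module.Finite A P ∧
      Function.Surjective g ∧ IsCDualizable B C (ModuleCat.of A (LinearMap.ker g)) := by
  obtain ⟨P, g, h1, h2, hg, hK⟩ := isSyzygyClosed_isSuperFinitelyPresented _ hX.sfp
  have hex : Function.Exact (LinearMap.ker g).subtype g := LinearMap.exact_subtype_ker_map g
  refine ⟨P, g, h1, h2, hg, hK, fun i => ?_, ?_⟩
  · exact (ext_shift_left _ (Submodule.subtype_injective _) hex hg i).1 (hX.ext (i + 1))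
  · exact IsSuperFinitelyPresented.cokernel (dualMap_injective hg) (dualMap_exact hex hg)
      (hX.dualMap_surjective (Submodule.subtype_injective _) hex hg) hX.sfp_dual
      (isSuperFinitelyPresented_dual hC P)

/-- The isomorphism `B ≃ Hom_A(C, C)` given by a bijective homothety map. -/
noncomputable def homothetyEquiv
    (h : Function.Bijective fun b : B => b • (LinearMap.id : C →ₗ[A] C)) :
    B ≃ₗ[B] (C →ₗ[A] C) :=
  LinearEquiv.ofBijective
    { toFun := fun b : B => b • (LinearMap.id : C →ₗ[A] C)
      map_add' := fun b b' => LinearMap.ext fun c => add_smul b b' c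
      map_smul' := fun b b' => LinearMap.ext fun c => mul_smul b b' c } h

theorem homothetyEquiv_one (h : Function.Bijective fun b : B => b • (LinearMap.id : C →ₗ[A] C)) :
    homothetyEquiv h (1 : B) = (LinearMap.id : C →ₗ[A] C) :=
  LinearMap.ext fun c => one_smul B c

/-- By homothety the dual of `C` is `B` itself, free of rank one. -/
theorem isCDualizable_self (hA : IsSuperFinitelyPresented (ModuleCat.of A C))
    (hext : ∀ i : ℕ, 1 ≤ i → Subsingleton (Ext (ModuleCat.of A C) (ModuleCat.of A C) i))
    (h : Function.Bijective fun b : B => b • (LinearMap.id : C →ₗ[A] C)) :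
    IsCDualizable B C (ModuleCat.of A C) :=
  ⟨hA, fun i => hext _ (Nat.le_add_left 1 i),
    (IsSuperFinitelyPresented.of_projective B).of_equiv (homothetyEquiv h)⟩

end Duals

/-! ### Weak dimensions as vanishing in a single degree. -/

section WeakDimensions

open Abelian

/-- Vanishing climbs in degree because syzygies of the test modules can be chosen among the test
modules. -/
theorem tor_of_forall_superFinitelyPresented {R : Type u} [Ring R] {M : ModuleCat.{u} R} {k : ℕ}
    (h : ∀ F : ModuleCat.{u} Rᵐᵒᵖ, IsSuperFinitelyPresented F → Subsingleton (Tor R F M (k + 1)))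
    (i : ℕ) (hi : k ≤ i) (F : ModuleCat.{u} Rᵐᵒᵖ) (hF : IsSuperFinitelyPresented F) :
    Subsingleton (Tor R F M (i + 1)) := by
  induction i, hi using Nat.le_induction generalizing F with
  | base => exact h F hF
  | succ i _ ih =>
    obtain ⟨P, g, _, _, hg, hK⟩ := isSyzygyClosed_isSuperFinitelyPresented _ hF
    exact (tor_shift_left (M := M) (f := (LinearMap.ker g).subtype) (g := g)
      (Submodule.subtype_injective _) (LinearMap.exact_subtype_ker_map g) hg i).2
      (ih (ModuleCat.of Rᵐᵒᵖ (LinearMap.ker g)) hK)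

theorem ext_of_forall_superFinitelyPresented {S : Type u} [Ring S] {N : ModuleCat.{u} S} {k : ℕ}
    (h : ∀ F : ModuleCat.{u} S, IsSuperFinitelyPresented F → Subsingleton (Ext F N (k + 1)))
    (i : ℕ) (hi : k ≤ i) (F : ModuleCat.{u} S) (hF : IsSuperFinitelyPresented F) :
    Subsingleton (Ext F N (i + 1)) := by
  induction i, hi using Nat.le_induction generalizing F with
  | base => exact h F hF
  | succ i _ ih =>
    obtain ⟨P, g, _, _, hg, hK⟩ := isSyzygyClosed_isSuperFinitelyPresented _ hF
    exact (ext_shift_left N (Submodule.subtype_injective _)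
      (LinearMap.exact_subtype_ker_map g) hg i).2 (ih _ hK)

theorem WFLE_iff {R : Type u} [Ring R] {n : ℕ} {M : ModuleCat.{u} R} : WFLE R n M ↔
    ∀ F : ModuleCat.{u} Rᵐᵒᵖ, IsSuperFinitelyPresented F → Subsingleton (Tor R F M (n + 1)) := by
  constructor
  · intro h
    by_contra hn
    -- If vanishing fails for `n`, it fails for every `k ≤ n`, since it would propagate upwards;
    -- hence the infimum is at least `n + 1`.
    have : ((n + 1 : ℕ) : ℕ∞) ≤ weakFlatDim M := by
      refine le_iInf₂ fun k hk => ?_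
      by_contra hlt
      rw [Nat.cast_le, not_le, Nat.lt_succ_iff] at hlt
      exact hn (tor_of_forall_superFinitelyPresented hk n hlt)
    have h2 := this.trans h
    rw [Nat.cast_le] at h2
    lia
  · exact fun h => iInf₂_le n h

theorem WILE_iff {S : Type u} [Ring S] {n : ℕ} {N : ModuleCat.{u} S} : WILE S n N ↔
    ∀ F : ModuleCat.{u} S, IsSuperFinitelyPresented F → Subsingleton (Ext F N (n + 1)) := by
  constructor
  · intro h
    by_contra hn
    have : ((n + 1 : ℕ) : ℕ∞) ≤ weakInjectiveDim N := by
      refine le_iInf₂ fun k hk => ?_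
      by_contra hlt
      rw [Nat.cast_le, not_le, Nat.lt_succ_iff] at hlt
      exact hn (ext_of_forall_superFinitelyPresented hk n hlt)
    have h2 := this.trans h
    rw [Nat.cast_le] at h2
    lia
  · exact fun h => iInf₂_le n h

end WeakDimensions

open BalTensor Abelian

/-! ### Tensor evaluation: weak flat modules are Auslander. -/

section TensorEvaluation

variable {R S : Type u} [Ring R] [Ring S]
variable {C : Type u} [AddCommGroup C] [Module S C] [Module Rᵐᵒᵖ C] [SMulCommClass S Rᵐᵒᵖ C]

/-- `P` need not be projective: the chase uses a projective cover of `M` instead. This matters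
because the sequences of duals have no projective terms in general. -/
theorem mapLeft_injective_of_tor_one {K P N M : Type u} [AddCommGroup K] [Module Rᵐᵒᵖ K]
    [AddCommGroup P] [Module Rᵐᵒᵖ P] [AddCommGroup N] [Module Rᵐᵒᵖ N] [AddCommGroup M] [Module R M]
    {f : K →ₗ[Rᵐᵒᵖ] P} {g : P →ₗ[Rᵐᵒᵖ] N} (hf : Function.Injective f) (hfg : Function.Exact f g)
    (hg : Function.Surjective g) (h : Subsingleton (Tor R N (ModuleCat.of R M) 1)) :
    Function.Injective (mapLeft M f) := by
  obtain ⟨L, Q, _, _, _, _, _, j, p, hj, hjp, hp⟩ := exists_projective_presentation R M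
  exact mapLeft_injective_of_map_injective hfg hg hjp hp (mapLeft_injective hf)
    ((tor_shift_right N hj hjp hp).1.1 h)

variable {X Y : Type u} [AddCommGroup X] [Module S X] [AddCommGroup Y] [Module S Y]
variable {M : Type u} [AddCommGroup M] [Module R M]

variable (R S C X M) in
/-- The tensor evaluation `Hom_S(X, C) ⊗_R M → Hom_S(X, C ⊗_R M)`. -/
def tensorEval : BalTensor R ℤ (X →ₗ[S] C) M →+ (X →ₗ[S] BalTensor R S C M) :=
  BalTensor.lift
    (AddMonoidHom.mk' (fun φ => AddMonoidHom.mk'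
      (fun m => (show C →ₗ[S] BalTensor R S C M from evalMu R S C M m) ∘ₗ φ)
      (fun a b => by
        ext x
        exact BalTensor.tmul_add _ _ _))
      (fun a b => by
        ext m x
        exact BalTensor.add_tmul _ _ _))
    (fun r φ m => by
      ext x
      exact BalTensor.smul_tmul R S C r (φ x) m)

theorem tensorEval_tmul (φ : X →ₗ[S] C) (m : M) (x : X) :
    tensorEval R S C X M (tmul R ℤ φ m) x = tmul R S (φ x) m := rfl

theorem tensorEval_mapLeft (f : X →ₗ[S] Y) (t : BalTensor R ℤ (Y →ₗ[S] C) M) :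
    tensorEval R S C X M (mapLeft M (dualMap Rᵐᵒᵖ C f) t) = tensorEval R S C Y M t ∘ₗ f := by
  induction t using BalTensor.induction_on with
  | zero => simp
  | tmul φ m => rfl
  | add x y hx hy => simp only [map_add, hx, hy, LinearMap.add_comp]

theorem tensorEval_bijective_of_projective [Module.Projective S X] [Module.Finite S X] :
    Function.Bijective (tensorEval R S C X M) := by
  obtain ⟨n, b, φ, h⟩ := exists_dualBasis S X
  -- In terms of a dual basis, the inverse sends `g` to the sum of the tensors `φ_j(-) g(b_j)`.
  let inv : (X →ₗ[S] BalTensor R S C M) → BalTensor R ℤ (X →ₗ[S] C) M := fun g =>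
    ∑ j, mapLeft M (coordMap Rᵐᵒᵖ C (φ j)) (equivInt R S C M (g (b j)))
  refine Function.bijective_iff_has_inverse.2 ⟨inv, fun t => ?_, fun g => ?_⟩
  · induction t using BalTensor.induction_on with
    | zero => simp [inv]
    | tmul f m =>
      simp only [inv, tensorEval_tmul, equivInt_tmul, mapLeft_tmul]
      conv_rhs => rw [← sum_coordMap (B := Rᵐᵒᵖ) h f]
      exact (map_sum (AddMonoidHom.mk' (fun f : X →ₗ[S] C => tmul R ℤ f m)
        fun a b => BalTensor.add_tmul a b m) _ _).symm
    | add x y hx hy =>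
      conv_rhs => rw [← hx, ← hy]
      simp only [inv, map_add, LinearMap.add_apply, Finset.sum_add_distrib]
  · have key : ∀ (j : Fin n) (t : BalTensor R S C M) (x : X),
        tensorEval R S C X M (mapLeft M (coordMap Rᵐᵒᵖ C (φ j)) (equivInt R S C M t)) x =
          φ j x • t := by
      intro j t x
      induction t using BalTensor.induction_on with
      | zero => simp
      | tmul c m => exact BalTensor.smul_tmul_left _ _ _
      | add x y hx hy => simp only [map_add, LinearMap.add_apply, hx, hy, smul_add]
    ext x
    simp only [inv, map_sum, LinearMap.sum_apply, key]
    conv_rhs => rw [← h x, map_sum]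
    simp

section Dualizable

/-- Weak flatness against `K*` makes `X* ⊗ M → P* ⊗ M` injective, and evaluation is bijective for
`P`. -/
theorem tensorEval_injective (hC : IsSuperFinitelyPresented (ModuleCat.of Rᵐᵒᵖ C))
    (hM : WF R (ModuleCat.of R M)) {X : ModuleCat.{u} S} (hX : IsCDualizable Rᵐᵒᵖ C X) :
    Function.Injective (tensorEval R S C X M) := by
  obtain ⟨P, g, _, _, hg, hK⟩ := hX.exists_syzygy hC
  have hex := LinearMap.exact_subtype_ker_map g
  have h1 : Function.Injective (mapLeft M (dualMap Rᵐᵒᵖ C g)) :=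
    mapLeft_injective_of_tor_one (dualMap_injective hg) (dualMap_exact hex hg)
      (hX.dualMap_surjective (Submodule.subtype_injective _) hex hg)
      (hM (ModuleCat.of Rᵐᵒᵖ (LinearMap.ker g →ₗ[S] C)) hK.sfp_dual)
  refine (injective_iff_map_eq_zero _).2 fun t ht => ?_
  rw [← map_eq_zero_iff _ h1, ← map_eq_zero_iff _ tensorEval_bijective_of_projective.1,
    tensorEval_mapLeft, ht, LinearMap.zero_comp]

theorem tensorEval_bijective (hC : IsSuperFinitelyPresented (ModuleCat.of Rᵐᵒᵖ C))
    (hM : WF R (ModuleCat.of R M)) {X : ModuleCat.{u} S} (hX : IsCDualizable Rᵐᵒᵖ C X) :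
    Function.Bijective (tensorEval R S C X M) := by
  refine ⟨tensorEval_injective hC hM hX, fun φ => ?_⟩
  obtain ⟨P, g, _, _, hg, hK⟩ := hX.exists_syzygy hC
  have hex := LinearMap.exact_subtype_ker_map g
  have h2 := mapLeft_exact (M := M) (dualMap_exact (B := Rᵐᵒᵖ) (C := C) hex hg)
    (hX.dualMap_surjective (Submodule.subtype_injective _) hex hg)
  obtain ⟨t, ht⟩ := (tensorEval_bijective_of_projective (R := R) (S := S) (C := C) (M := M)).2 (φ ∘ₗ g)
  -- Evaluation is already injective for the syzygy, and there the image of `t` is `φ ∘ g`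
  -- restricted to `ker g`, which is zero. So `t` comes from `X* ⊗ M`.
  have h3 : mapLeft M (dualMap Rᵐᵒᵖ C (LinearMap.ker g).subtype) t = 0 := by
    refine (map_eq_zero_iff _ (tensorEval_injective hC hM hK)).1 ?_
    refine (tensorEval_mapLeft _ _).trans ?_
    rw [ht]
    ext x
    have : g x.1 = 0 := x.2
    simp [this]
  obtain ⟨t, rfl⟩ := (h2 t).1 h3
  rw [tensorEval_mapLeft] at ht
  exact ⟨t, (LinearMap.cancel_right hg).1 ht⟩

/-- A map from the syzygy `K` to `C ⊗ M` is the evaluation of an element of `K* ⊗ M`. That element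
lifts to `P* ⊗ M`, so the map extends to `P`; higher degrees follow by shifting. -/
theorem ext_tensor_of_isCDualizable (hC : IsSuperFinitelyPresented (ModuleCat.of Rᵐᵒᵖ C))
    (hM : WF R (ModuleCat.of R M)) {X : ModuleCat.{u} S} (hX : IsCDualizable Rᵐᵒᵖ C X) (i : ℕ) :
    Subsingleton (Ext X (ModuleCat.of S (BalTensor R S C M)) (i + 1)) := by
  induction i generalizing X with
  | zero =>
    obtain ⟨P, g, _, _, hg, hK⟩ := hX.exists_syzygy hC
    have hex := LinearMap.exact_subtype_ker_map g
    refine ext_one_of_hom_extend _ (Submodule.subtype_injective _) hex hg fun φ => ?_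
    obtain ⟨t, rfl⟩ := (tensorEval_bijective hC hM hK).2 φ
    obtain ⟨t, rfl⟩ := mapLeft_surjective
      (hX.dualMap_surjective (Submodule.subtype_injective _) hex hg) t
    exact ⟨tensorEval R S C P M t, (tensorEval_mapLeft _ _).symm⟩
  | succ i ih =>
    obtain ⟨P, g, _, _, hg, hK⟩ := hX.exists_syzygy hC
    exact (ext_shift_left _ (Submodule.subtype_injective _)
      (LinearMap.exact_subtype_ker_map g) hg i).2 (ih hK)

end Dualizable

theorem tmul_bijective_of_equiv {N : Type u} [AddCommGroup N] [Module Rᵐᵒᵖ N]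
    (e : Rᵐᵒᵖ ≃ₗ[Rᵐᵒᵖ] N) : Function.Bijective fun m : M => tmul R ℤ (e 1) m := by
  let inv : BalTensor R ℤ N M →+ M := BalTensor.lift
    (AddMonoidHom.mk' (fun n => AddMonoidHom.mk' (fun m => (e.symm n).unop • m)
      (fun a b => smul_add _ _ _)) (fun a b => by ext; simp [add_smul]))
    (fun r n m => by simp [mul_smul])
  refine Function.bijective_iff_has_inverse.2 ⟨inv, fun m => ?_, fun t => ?_⟩
  · simp [inv]
  · induction t using BalTensor.induction_on with
    | zero => simp
    | tmul n m =>
      change tmul R ℤ (e 1) ((e.symm n).unop • m) = _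
      rw [← BalTensor.smul_tmul, MulOpposite.op_unop, ← map_smul, smul_eq_mul, mul_one,
        LinearEquiv.apply_symm_apply]
    | add x y hx hy =>
      simp only at hx hy
      simp only [map_add, BalTensor.tmul_add, hx, hy]

theorem WF_le_auslanderClass (hC : IsSemidualizing R S C) : WF R ≤ AuslanderClass R S C := by
  intro M hM
  have hb : Function.Bijective fun b : Rᵐᵒᵖ => b • (LinearMap.id : C →ₗ[S] C) :=
    hC.b2.comp MulOpposite.opEquiv.symm.bijective
  have hX : IsCDualizable Rᵐᵒᵖ C (ModuleCat.of S C) := isCDualizable_self hC.a1 hC.c1 hb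
  refine ⟨fun i hi => ?_, fun i hi => ?_, ?_⟩
  · obtain ⟨i, rfl⟩ := Nat.exists_eq_add_of_le' hi
    exact tor_of_forall_superFinitelyPresented (k := 0) hM i (Nat.zero_le i) (ModuleCat.of Rᵐᵒᵖ C)
      hC.a2
  · obtain ⟨i, rfl⟩ := Nat.exists_eq_add_of_le' hi
    exact ext_tensor_of_isCDualizable hC.a2 hM hX i
  -- `μ_M` factors as `M ≅ Hom_S(C, C) ⊗ M → Hom_S(C, C ⊗ M)`, the first map being `m ↦ id ⊗ m`.
  · have h := (tensorEval_bijective (M := M) hC.a2 hM hX).comp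
      (tmul_bijective_of_equiv (M := M) (homothetyEquiv hb))
    rw [homothetyEquiv_one] at h
    exact h

end TensorEvaluation

/-! ### Hom evaluation: weak injective modules are Bass. -/

section HomEvaluation

variable {R S : Type u} [Ring R] [Ring S]
variable {C : Type u} [AddCommGroup C] [Module S C] [Module Rᵐᵒᵖ C] [SMulCommClass S Rᵐᵒᵖ C]
  [SMulCommClass Rᵐᵒᵖ S C]
variable {X Y : Type u} [AddCommGroup X] [Module Rᵐᵒᵖ X] [AddCommGroup Y] [Module Rᵐᵒᵖ Y]
variable {N : Type u} [AddCommGroup N] [Module S N]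

variable (S C) in
/-- Evaluation at `x`, an `S`-linear map `Hom_{Rᵒᵖ}(X, C) → C`. -/
def evalAt (x : X) : (X →ₗ[Rᵐᵒᵖ] C) →ₗ[S] C where
  toFun h := h x
  map_add' _ _ := rfl
  map_smul' _ _ := rfl

variable (R S C X N) in
/-- The Hom evaluation `X ⊗_R Hom_S(C, N) → Hom_S(Hom_{Rᵒᵖ}(X, C), N)`. -/
def homEval : BalTensor R ℤ X (BimodHom R S C N) →+ ((X →ₗ[Rᵐᵒᵖ] C) →ₗ[S] N) :=
  BalTensor.lift
    (AddMonoidHom.mk' (fun x => AddMonoidHom.mk'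
      (fun f => (show C →ₗ[S] N from f) ∘ₗ evalAt S C x)
      (fun a b => rfl))
      (fun a b => by
        ext f h
        exact (congrArg (show C →ₗ[S] N from f) (map_add h a b)).trans
          (map_add (show C →ₗ[S] N from f) _ _)))
    (fun r x f => by
      ext h
      exact congrArg (show C →ₗ[S] N from f) (map_smul h (MulOpposite.op r) x))

theorem homEval_mapLeft (f : X →ₗ[Rᵐᵒᵖ] Y) (t : BalTensor R ℤ X (BimodHom R S C N)) :
    homEval R S C Y N (mapLeft _ f t) = homEval R S C X N t ∘ₗ dualMap S C f := by
  induction t using BalTensor.induction_on with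
  | zero => simp
  | tmul φ m => rfl
  | add x y hx hy => simp only [map_add, hx, hy, LinearMap.add_comp]

theorem homEval_bijective_of_projective [Module.Projective Rᵐᵒᵖ X] [Module.Finite Rᵐᵒᵖ X] :
    Function.Bijective (homEval R S C X N) := by
  obtain ⟨n, b, φ, h⟩ := exists_dualBasis Rᵐᵒᵖ X
  let inv : ((X →ₗ[Rᵐᵒᵖ] C) →ₗ[S] N) → BalTensor R ℤ X (BimodHom R S C N) := fun g =>
    ∑ j, tmul R ℤ (b j) (show BimodHom R S C N from g ∘ₗ coordMap S C (φ j))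
  refine Function.bijective_iff_has_inverse.2 ⟨inv, fun t => ?_, fun g => ?_⟩
  · induction t using BalTensor.induction_on with
    | zero =>
      refine Finset.sum_eq_zero fun j _ => ?_
      exact BalTensor.tmul_zero _
    | tmul x f =>
      have key : ∀ j, tmul R ℤ (b j)
          (show BimodHom R S C N from homEval R S C X N (tmul R ℤ x f) ∘ₗ coordMap S C (φ j)) =
          tmul R ℤ (φ j x • b j) f := fun j => (BalTensor.smul_tmul R ℤ X (φ j x).unop (b j) f).symm
      simp only [inv, key]
      conv_rhs => rw [← h x]
      exact (map_sum (AddMonoidHom.mk' (fun x : X => tmul R ℤ x f)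
        fun a b => BalTensor.add_tmul a b f) _ _).symm
    | add x y hx hy =>
      conv_rhs => rw [← hx, ← hy]
      simp only [inv, ← Finset.sum_add_distrib, map_add]
      refine Finset.sum_congr rfl fun j _ => ?_
      exact BalTensor.tmul_add (M := BimodHom R S C N) (b j)
        (homEval R S C X N x ∘ₗ coordMap S C (φ j)) (homEval R S C X N y ∘ₗ coordMap S C (φ j))
  · ext f
    simp only [inv, map_sum, LinearMap.sum_apply]
    conv_rhs => rw [← sum_coordMap (B := S) h f, map_sum]
    rfl

/-- The cokernel `K*` of `X* → P*` is super finitely presented, so weak injectivity of `N` extends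
maps from `X*` to `P*`, where evaluation is bijective. -/
theorem homEval_surjective (hC : IsSuperFinitelyPresented (ModuleCat.of S C))
    (hN : WI S (ModuleCat.of S N)) {X : ModuleCat.{u} Rᵐᵒᵖ} (hX : IsCDualizable S C X) :
    Function.Surjective (homEval R S C X N) := by
  intro φ
  obtain ⟨P, g, _, _, hg, hK⟩ := hX.exists_syzygy hC
  have hex := LinearMap.exact_subtype_ker_map g
  obtain ⟨ψ, hψ⟩ := hom_extend_of_ext_one (ModuleCat.of S N) (dualMap_injective hg)
    (dualMap_exact (B := S) (C := C) hex hg)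
    (hX.dualMap_surjective (Submodule.subtype_injective _) hex hg) (hN _ hK.sfp_dual) φ
  obtain ⟨t, rfl⟩ := homEval_bijective_of_projective.2 ψ
  exact ⟨mapLeft _ g t, (homEval_mapLeft g t).trans hψ⟩

/-- Compared with tensor evaluation the order is reversed: injectivity for `X` rests on surjectivity
for its syzygy, since a lift of `t` to `P ⊗ Hom(C, N)` evaluates to a map that factors through `K*`.
-/
theorem homEval_bijective (hC : IsSuperFinitelyPresented (ModuleCat.of S C))
    (hN : WI S (ModuleCat.of S N)) {X : ModuleCat.{u} Rᵐᵒᵖ} (hX : IsCDualizable S C X) :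
    Function.Bijective (homEval R S C X N) := by
  refine ⟨(injective_iff_map_eq_zero _).2 fun t ht => ?_, homEval_surjective hC hN hX⟩
  obtain ⟨P, g, _, _, hg, hK⟩ := hX.exists_syzygy hC
  have hex := LinearMap.exact_subtype_ker_map g
  obtain ⟨t, rfl⟩ := mapLeft_surjective hg t
  rw [homEval_mapLeft] at ht
  obtain ⟨χ, hχ⟩ := exists_factor_of_exact (dualMap_exact (B := S) (C := C) hex hg)
    (hX.dualMap_surjective (Submodule.subtype_injective _) hex hg) _ ht
  obtain ⟨v, rfl⟩ := homEval_surjective hC hN hK χ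
  have h2 : mapLeft _ (LinearMap.ker g).subtype v = t :=
    homEval_bijective_of_projective.1 ((homEval_mapLeft _ _).trans hχ)
  rw [← h2]
  exact (mapLeft_exact hex hg).apply_apply_eq_zero v

/-- In degree one, an element of `K ⊗ Hom(C, N)` that dies over `P` evaluates to a map on `K*`
vanishing on the image of `P*`, which is all of `K*`. -/
theorem tor_hom_of_isCDualizable (hC : IsSuperFinitelyPresented (ModuleCat.of S C))
    (hN : WI S (ModuleCat.of S N)) {X : ModuleCat.{u} Rᵐᵒᵖ} (hX : IsCDualizable S C X) (i : ℕ) :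
    Subsingleton (Tor R X (ModuleCat.of R (BimodHom R S C N)) (i + 1)) := by
  induction i generalizing X with
  | zero =>
    obtain ⟨P, g, _, _, hg, hK⟩ := hX.exists_syzygy hC
    have hex := LinearMap.exact_subtype_ker_map g
    refine (tor_one_iff_left (Submodule.subtype_injective _) hex hg).2 ?_
    refine (injective_iff_map_eq_zero _).2 fun v hv => ?_
    refine (map_eq_zero_iff _ (homEval_bijective hC hN hK).1).1 ?_
    refine (LinearMap.cancel_right
      (hX.dualMap_surjective (Submodule.subtype_injective _) hex hg)).1 ?_
    refine (homEval_mapLeft _ _).symm.trans ?_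
    rw [hv, map_zero, LinearMap.zero_comp]
  | succ i ih =>
    obtain ⟨P, g, _, _, hg, hK⟩ := hX.exists_syzygy hC
    exact (tor_shift_left (f := (LinearMap.ker g).subtype) (g := g)
      (Submodule.subtype_injective _) (LinearMap.exact_subtype_ker_map g) hg i).2
      (ih (X := ModuleCat.of Rᵐᵒᵖ (LinearMap.ker g)) hK)

end HomEvaluation

theorem WI_le_bassClass {R S : Type u} [Ring R] [Ring S]
    {C : Type u} [AddCommGroup C] [Module S C] [Module Rᵐᵒᵖ C] [SMulCommClass S Rᵐᵒᵖ C]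
    (hC : IsSemidualizing R S C) : WI S ≤ BassClass R S C := by
  intro N hN
  have := SMulCommClass.symm S Rᵐᵒᵖ C
  have hb : Function.Bijective fun b : S => b • (LinearMap.id : C →ₗ[Rᵐᵒᵖ] C) := hC.b1
  have hX : IsCDualizable S C (ModuleCat.of Rᵐᵒᵖ C) := isCDualizable_self hC.a2 hC.c2 hb
  refine ⟨fun i hi => ?_, fun i hi => ?_, ?_⟩
  · obtain ⟨i, rfl⟩ := Nat.exists_eq_add_of_le' hi
    exact ext_of_forall_superFinitelyPresented (k := 0) hN i (Nat.zero_le i) (ModuleCat.of S C)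
      hC.a1
  · obtain ⟨i, rfl⟩ := Nat.exists_eq_add_of_le' hi
    exact tor_hom_of_isCDualizable hC.a1 hN hX i
  · have h1 := homEval_bijective (N := N) hC.a1 hN hX
    -- `Hom_{Rᵒᵖ}(C, C)` is free over `S` on the identity, so a map out of it is its value there;
    -- `ν_N` is Hom evaluation followed by this identification.
    have h2 : Function.Bijective fun φ : (C →ₗ[Rᵐᵒᵖ] C) →ₗ[S] N => φ LinearMap.id := by
      let e := homothetyEquiv hb
      have he : e (1 : S) = LinearMap.id := homothetyEquiv_one hb
      refine ⟨fun φ ψ h => ?_, fun y =>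
        ⟨LinearMap.toSpanSingleton S N y ∘ₗ e.symm.toLinearMap, ?_⟩⟩
      · ext f
        obtain ⟨s, rfl⟩ := e.surjective f
        have hs : e s = s • LinearMap.id := by rw [← he, ← map_smul, smul_eq_mul, mul_one]
        rw [hs, map_smul, map_smul]
        exact congrArg _ h
      · simp [← he]
    have h3 : (evalNu R S C N : _ → _) =
        (fun φ : (C →ₗ[Rᵐᵒᵖ] C) →ₗ[S] N => φ LinearMap.id) ∘ homEval R S C C N ∘
          equivInt R S C (BimodHom R S C N) := by
      funext t
      induction t using BalTensor.induction_on with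
      | zero => simp
      | tmul c f => rfl
      | add x y hx hy =>
        simp only [Function.comp_apply] at hx hy
        simp only [Function.comp_apply, map_add, LinearMap.add_apply, hx, hy]
    rw [h3]
    exact h2.comp (h1.comp (equivInt R S C _).bijective)

theorem BimodHom.ext {R S : Type u} [Ring S] {C N : Type u} [AddCommGroup C] [Module S C]
    [AddCommGroup N] [Module S N] {f g : BimodHom R S C N} (h : ∀ c, f c = g c) : f = g :=
  LinearMap.ext (f := (show C →ₗ[S] N from f)) (g := g) h

/-! ### The evaluation maps and closure of the Auslander and Bass classes. -/

section Evaluation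

variable {R S : Type u} [Ring R] [Ring S]
variable {C : Type u} [AddCommGroup C] [Module S C] [Module Rᵐᵒᵖ C] [SMulCommClass S Rᵐᵒᵖ C]

section

variable {M M' : Type u} [AddCommGroup M] [Module R M] [AddCommGroup M'] [Module R M']
variable {N N' N'' : Type u} [AddCommGroup N] [Module S N] [AddCommGroup N'] [Module S N']
  [AddCommGroup N''] [Module S N'']

theorem map_evalMu (f : M →ₗ[R] M') (m : M) :
    BimodHom.map R S C (BalTensor.map R S C f) (evalMu R S C M m) = evalMu R S C M' (f m) :=
  BimodHom.ext fun c => BalTensor.map_tmul R S C f c m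

theorem evalNu_map (g : N →ₗ[S] N') (t : BalTensor R S C (BimodHom R S C N)) :
    evalNu R S C N' (BalTensor.map R S C (BimodHom.map R S C g) t) = g (evalNu R S C N t) := by
  induction t using BalTensor.induction_on with
  | zero => simp
  | tmul c f => simp [BimodHom.map]; rfl
  | add x y hx hy => simp only [map_add, hx, hy]

/-- Together with `map_evalNu_evalMu`, these are the triangle identities, which make `ν` invertible
at `C ⊗ M` once `μ_M` is, and `μ` invertible at `Hom(C, N)` once `ν_N` is. -/
theorem evalNu_map_evalMu (t : BalTensor R S C M) :
    evalNu R S C _ (BalTensor.map R S C (evalMu R S C M) t) = t := by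
  induction t using BalTensor.induction_on with
  | zero => simp
  | tmul c f => simp; rfl
  | add x y hx hy => simp only [map_add, hx, hy]

theorem map_evalNu_evalMu (f : BimodHom R S C N) :
    BimodHom.map R S C (evalNu R S C N) (evalMu R S C _ f) = f :=
  BimodHom.ext fun c => evalNu_tmul R S C N c f

theorem BimodHom.map_injective {f : N →ₗ[S] N'} (hf : Function.Injective f) :
    Function.Injective (BimodHom.map R S C f) := fun _ _ h =>
  (LinearMap.cancel_left hf).1 h

theorem BimodHom.map_exact {f : N →ₗ[S] N'} {g : N' →ₗ[S] N''} (hf : Function.Injective f)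
    (h : Function.Exact f g) :
    Function.Exact (BimodHom.map R S C f) (BimodHom.map R S C g) := by
  intro φ
  constructor
  · intro hφ
    have hφ : ∀ c, g (φ c) = 0 := fun c => congrArg (fun ψ : BimodHom R S C N'' => ψ c) hφ
    refine ⟨(LinearEquiv.ofInjective f hf).symm.toLinearMap ∘ₗ
      LinearMap.codRestrict (LinearMap.range f) (show C →ₗ[S] N' from φ)
        fun c => (h _).1 (hφ c), BimodHom.ext fun c => ?_⟩
    exact congrArg Subtype.val ((LinearEquiv.ofInjective f hf).apply_symm_apply _)
  · rintro ⟨ψ, rfl⟩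
    exact BimodHom.ext fun c => h.apply_apply_eq_zero _

end

section FiveLemma

variable {X Y Z X' Y' Z' : Type*} [AddCommGroup X] [AddCommGroup Y] [AddCommGroup Z]
  [AddCommGroup X'] [AddCommGroup Y'] [AddCommGroup Z']
  {f : X → Y} {g : Y → Z} {f' : X' → Y'} {g' : Y' → Z'}
  {α : X →+ X'} {β : Y →+ Y'} {γ : Z →+ Z'}

theorem bijective_of_cokernels (hg : Function.Surjective g)
    (hfg : Function.Exact f g) (hg' : Function.Surjective g')
    (hfg' : Function.Exact f' g') (hαβ : ∀ x, β (f x) = f' (α x)) (hβγ : ∀ y, γ (g y) = g' (β y))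
    (hα : Function.Surjective α) (hβ : Function.Bijective β) : Function.Bijective γ := by
  constructor
  · refine (injective_iff_map_eq_zero γ).2 fun z hz => ?_
    obtain ⟨y, rfl⟩ := hg z
    rw [hβγ] at hz
    obtain ⟨x', hx'⟩ := (hfg' _).1 hz
    obtain ⟨x, rfl⟩ := hα x'
    rw [← hαβ] at hx'
    exact (hfg y).2 ⟨x, hβ.1 hx'⟩
  · intro z'
    obtain ⟨y', rfl⟩ := hg' z'
    obtain ⟨y, rfl⟩ := hβ.2 y'
    exact ⟨g y, hβγ y⟩

theorem bijective_of_kernels (hf : Function.Injective f) (hf' : Function.Injective f')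
    (hfg : Function.Exact f g) (hfg' : Function.Exact f' g') (hαβ : ∀ x, β (f x) = f' (α x))
    (hβγ : ∀ y, γ (g y) = g' (β y)) (hβ : Function.Bijective β) (hγ : Function.Injective γ) :
    Function.Bijective α := by
  constructor
  · intro x y h
    refine hf (hβ.1 ?_)
    rw [hαβ, hαβ, h]
  · intro x'
    obtain ⟨y, hy⟩ := hβ.2 (f' x')
    have h : g y = 0 := (map_eq_zero_iff γ hγ).1 (by rw [hβγ, hy]; exact (hfg' _).2 ⟨x', rfl⟩)
    obtain ⟨x, rfl⟩ := (hfg y).1 h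
    rw [hαβ] at hy
    exact ⟨x, hf' hy⟩

end FiveLemma

section Isomorphisms

theorem bijective_of_comp_left {X Y Z : Type*} {f : Y → Z} {g : X → Y} {h : X → Z}
    (e : ∀ x, f (g x) = h x) (hg : Function.Bijective g) (hh : Function.Bijective h) :
    Function.Bijective f := by
  rw [← Function.Bijective.of_comp_iff f hg, show f ∘ g = h from funext e]
  exact hh

theorem bijective_of_comp_right {X Y Z : Type*} {f : Y → Z} {g : X → Y} {h : X → Z}
    (e : ∀ x, f (g x) = h x) (hf : Function.Bijective f) (hh : Function.Bijective h) :
    Function.Bijective g := by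
  rw [← Function.Bijective.of_comp_iff' hf g, show f ∘ g = h from funext e]
  exact hh

/-- The evaluation map `μ_M` as an isomorphism, for `M` in the Auslander class. -/
noncomputable def AuslanderClass.muIso {M : ModuleCat.{u} R} (hM : AuslanderClass R S C M) :
    M ≅ (homFunctor R S C).obj ((tensorFunctor R S C).obj M) :=
  (LinearEquiv.ofBijective (evalMu R S C M) hM.a3).toModuleIso

/-- The evaluation map `ν_N` as an isomorphism, for `N` in the Bass class. -/
noncomputable def BassClass.nuIso {N : ModuleCat.{u} S} (hN : BassClass R S C N) :
    (tensorFunctor R S C).obj ((homFunctor R S C).obj N) ≅ N :=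
  (LinearEquiv.ofBijective (evalNu R S C N) hN.b3).toModuleIso

theorem bijective_of_iso {A : Type u} [Ring A] {M N : ModuleCat.{u} A} (e : M ≅ N) :
    Function.Bijective e.hom.hom := e.toLinearEquiv.bijective

theorem AuslanderClass.of_iso {M M' : ModuleCat.{u} R} (e : M ≅ M')
    (hM : AuslanderClass R S C M) : AuslanderClass R S C M' :=
  ⟨fun i hi => (subsingleton_tor_iff_of_iso C e i).1 (hM.a1 i hi),
    fun i hi => subsingleton_ext_of_iso _ ((tensorFunctor R S C).mapIso e) i (hM.a2 i hi),
    bijective_of_comp_left (fun m => (map_evalMu e.hom.hom m).symm) (bijective_of_iso e)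
      ((bijective_of_iso ((homFunctor R S C).mapIso ((tensorFunctor R S C).mapIso e))).comp hM.a3)⟩

theorem BassClass.of_iso {N N' : ModuleCat.{u} S} (e : N ≅ N')
    (hN : BassClass R S C N) : BassClass R S C N' :=
  ⟨fun i hi => subsingleton_ext_of_iso _ e i (hN.b1 i hi),
    fun i hi => (subsingleton_tor_iff_of_iso C ((homFunctor R S C).mapIso e) i).1 (hN.b2 i hi),
    bijective_of_comp_left (fun t => evalNu_map e.hom.hom t)
      (bijective_of_iso ((tensorFunctor R S C).mapIso ((homFunctor R S C).mapIso e)))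
      ((bijective_of_iso e).comp hN.b3)⟩

theorem AuslanderClass.tensor {M : ModuleCat.{u} R} (hM : AuslanderClass R S C M) :
    BassClass R S C ((tensorFunctor R S C).obj M) :=
  ⟨hM.a2, fun i hi => (subsingleton_tor_iff_of_iso C hM.muIso i).1 (hM.a1 i hi),
    bijective_of_comp_left (fun t => evalNu_map_evalMu t)
      (bijective_of_iso ((tensorFunctor R S C).mapIso hM.muIso)) Function.bijective_id⟩

theorem BassClass.hom {N : ModuleCat.{u} S} (hN : BassClass R S C N) :
    AuslanderClass R S C ((homFunctor R S C).obj N) :=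
  ⟨hN.b2, fun i hi => subsingleton_ext_of_iso _ hN.nuIso.symm i (hN.b1 i hi),
    bijective_of_comp_right (fun t => map_evalNu_evalMu t)
      (bijective_of_iso ((homFunctor R S C).mapIso hN.nuIso)) Function.bijective_id⟩

end Isomorphisms

/-! ### Kernels and cokernels in the two classes. -/

section Closure

variable {M' M M'' : ModuleCat.{u} R} {a : M' →ₗ[R] M} {b : M →ₗ[R] M''}
variable {N' N N'' : ModuleCat.{u} S} {f : N' →ₗ[S] N} {g : N →ₗ[S] N''}

/-- A map from `C` into the kernel of `C ⊗ a` is evaluation at some `m`, and naturality of `μ` gives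
`a m = 0`, so `m = 0`. Thus `C` has no nonzero map into the kernel, and left faithfulness applies.
-/
theorem map_injective_of_auslander (hC : IsFaithfullySemidualizing R S C)
    (ha : Function.Injective a) (h' : AuslanderClass R S C M') (h : AuslanderClass R S C M) :
    Function.Injective (BalTensor.map R S C a) := by
  let K := LinearMap.ker (BalTensor.map R S C a)
  have hK : Subsingleton K := by
    refine hC.faithful_left (ModuleCat.of S K) (subsingleton_of_forall_eq 0 fun φ => ?_)
    obtain ⟨m, hm⟩ := h'.a3.2 (K.subtype ∘ₗ φ)
    have h0 : evalMu R S C M (a m) = 0 := by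
      rw [← map_evalMu, hm]
      exact BimodHom.ext fun c => (φ c).2
    rw [map_eq_zero_iff _ h.a3.1, map_eq_zero_iff _ ha] at h0
    rw [h0, map_zero] at hm
    ext c
    exact (congrArg (fun ψ : BimodHom R S C _ => ψ c) hm).symm
  exact LinearMap.ker_eq_bot.1 (Submodule.subsingleton_iff_eq_bot.1 hK)

theorem AuslanderClass.cokernel (hC : IsFaithfullySemidualizing R S C)
    (ha : Function.Injective a) (hab : Function.Exact a b) (hb : Function.Surjective b)
    (h' : AuslanderClass R S C M') (h : AuslanderClass R S C M) : AuslanderClass R S C M'' := by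
  have hinj := map_injective_of_auslander hC ha h' h
  have hex := map_exact' (S := S) (C := C) hab hb
  have hsurj := BalTensor.map_surjective (S := S) (C := C) hb
  refine ⟨fun i hi => ?_, fun i hi => ?_, ?_⟩
  · obtain ⟨i, rfl⟩ := Nat.exists_eq_add_of_le' hi
    cases i with
    | zero => exact tor_one_of_map_injective hab hb (h.a1 1 le_rfl) ((map_injective_iff a).1 hinj)
    | succ i => exact tor_succ_succ_of_shortExact ha hab hb i (h'.a1 _ (by lia)) (h.a1 _ (by lia))
  · exact ext_of_shortExact _ hinj hex hsurj i (h.a2 i hi) (h'.a2 _ (by lia))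
  · refine bijective_of_cokernels (α := (evalMu R S C M').toAddMonoidHom)
      (β := (evalMu R S C M).toAddMonoidHom) (γ := (evalMu R S C M'').toAddMonoidHom)
      hb hab (g' := BimodHom.map R S C (BalTensor.map R S C b)) ?_
      (BimodHom.map_exact hinj hex) (fun x => (map_evalMu a x).symm)
      (fun x => (map_evalMu b x).symm) h'.a3.2 h.a3
    exact hom_lift_of_ext_one (ModuleCat.of S C) hinj hex hsurj (h'.a2 1 le_rfl)

theorem AuslanderClass.map_injective (ha : Function.Injective a) (hab : Function.Exact a b)
    (hb : Function.Surjective b) (h'' : AuslanderClass R S C M'') :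
    Function.Injective (BalTensor.map R S C a) :=
  (map_injective_iff a).2 (map_injective_of_tor_one ha hab hb (h''.a1 1 le_rfl))

/-- No faithfulness is needed: `Tor₁(C, M'') = 0` already keeps the sequence exact under `C ⊗ -`. -/
theorem AuslanderClass.kernel
    (ha : Function.Injective a) (hab : Function.Exact a b) (hb : Function.Surjective b)
    (h : AuslanderClass R S C M) (h'' : AuslanderClass R S C M'') : AuslanderClass R S C M' := by
  have hinj := h''.map_injective ha hab hb
  have hex := map_exact' (S := S) (C := C) hab hb
  have hsurj := BalTensor.map_surjective (S := S) (C := C) hb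
  refine ⟨fun i hi => ?_, fun i hi => ?_, ?_⟩
  · obtain ⟨i, rfl⟩ := Nat.exists_eq_add_of_le' hi
    exact tor_succ_of_shortExact ha hab hb i (h.a1 _ hi) (h''.a1 _ (by lia))
  · obtain ⟨i, rfl⟩ := Nat.exists_eq_add_of_le' hi
    cases i with
    | zero =>
      -- A map `C → C ⊗ M''` is evaluation at an element of `M''`, and lifting that element to `M`
      -- lifts the map.
      refine ext_one_of_hom_lift _ hinj hex hsurj (h.a2 1 le_rfl) fun φ => ?_
      obtain ⟨m, hm⟩ := h''.a3.2 φ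
      obtain ⟨m, rfl⟩ := hb m
      exact ⟨evalMu R S C M m, (map_evalMu b m).trans hm⟩
    | succ i =>
      exact ext_succ_of_shortExact _ hinj hex hsurj (i + 1) (h.a2 _ hi) (h''.a2 _ (by lia))
  · exact bijective_of_kernels (α := (evalMu R S C M').toAddMonoidHom)
      (β := (evalMu R S C M).toAddMonoidHom) (γ := (evalMu R S C M'').toAddMonoidHom)
      ha (BimodHom.map_injective hinj) hab (BimodHom.map_exact hinj hex)
      (fun x => (map_evalMu a x).symm) (fun x => (map_evalMu b x).symm) h.a3 h''.a3.1

theorem BassClass.map_surjective (hf : Function.Injective f)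
    (hfg : Function.Exact f g) (hg : Function.Surjective g) (h' : BassClass R S C N') :
    Function.Surjective (BimodHom.map R S C g) :=
  hom_lift_of_ext_one (ModuleCat.of S C) hf hfg hg (h'.b1 1 le_rfl)

theorem BassClass.cokernel (hf : Function.Injective f)
    (hfg : Function.Exact f g) (hg : Function.Surjective g) (h' : BassClass R S C N')
    (h : BassClass R S C N) : BassClass R S C N'' := by
  have hsurj := h'.map_surjective hf hfg hg
  have hinj := BimodHom.map_injective (R := R) (C := C) hf
  have hex := BimodHom.map_exact (R := R) (C := C) hf hfg
  refine ⟨fun i hi => ?_, fun i hi => ?_, ?_⟩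
  · exact ext_of_shortExact _ hf hfg hg i (h.b1 i hi) (h'.b1 _ (by lia))
  · obtain ⟨i, rfl⟩ := Nat.exists_eq_add_of_le' hi
    cases i with
    | zero =>
      refine tor_one_of_map_injective hex hsurj (h.b2 1 le_rfl) ((map_injective_iff (S := S) _).1 ?_)
      -- Through `ν`, the map `C ⊗ Hom(C, f)` is identified with the injection `f`.
      refine Function.Injective.of_comp (f := evalNu R S C N) ?_
      have e : (evalNu R S C N : _ → _) ∘ BalTensor.map R S C (BimodHom.map R S C f) =
          f ∘ evalNu R S C N' := funext fun t => evalNu_map f t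
      rw [e]
      exact hf.comp h'.b3.1
    | succ i => exact tor_succ_succ_of_shortExact hinj hex hsurj i (h'.b2 _ (by lia)) (h.b2 _ hi)
  · exact bijective_of_cokernels (α := (evalNu R S C N').toAddMonoidHom)
      (β := (evalNu R S C N).toAddMonoidHom) (γ := (evalNu R S C N'').toAddMonoidHom)
      (BalTensor.map_surjective hsurj) (map_exact' hex hsurj) hg hfg
      (fun x => evalNu_map f x) (fun x => evalNu_map g x) h'.b3.2 h.b3

/-- Faithfulness of `C` on the right, in terms of the tensor product. -/
theorem subsingleton_of_subsingleton_tensor (hC : IsFaithfullySemidualizing R S C)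
    (K : Type u) [AddCommGroup K] [Module R K] (hK : Subsingleton (BalTensor R ℤ C K)) :
    Subsingleton K := by
  -- `D` is the character module of `K`, a right `R`-module. A map `C → D` is a character of `C ⊗
  -- K`, hence zero; right faithfulness gives `D = 0`, and characters separate the points of `K`.
  let D := K →+ AddCircle (1 : ℚ)
  let _ : Module Rᵐᵒᵖ D :=
    { smul := fun r χ => χ.comp (AddMonoidHom.mk' (fun k => r.unop • k) (smul_add r.unop))
      one_smul := fun χ => AddMonoidHom.ext fun k => congrArg χ (one_smul R k)
      mul_smul := fun r s χ => AddMonoidHom.ext fun k => congrArg χ (mul_smul s.unop r.unop k)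
      smul_zero := fun _ => rfl
      smul_add := fun _ _ _ => rfl
      add_smul := fun r s χ => AddMonoidHom.ext fun k =>
        (congrArg χ (add_smul r.unop s.unop k)).trans (map_add χ _ _)
      zero_smul := fun χ => AddMonoidHom.ext fun k =>
        (congrArg χ (zero_smul R k)).trans (map_zero χ) }
  have hD : Subsingleton D := by
    refine hC.faithful_right (ModuleCat.of Rᵐᵒᵖ D) (subsingleton_of_forall_eq 0 fun φ => ?_)
    let φ' : C →ₗ[Rᵐᵒᵖ] D := φ
    let l : BalTensor R ℤ C K →+ AddCircle (1 : ℚ) := BalTensor.lift φ'.toAddMonoidHom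
      fun r c k => congrArg (fun χ : D => χ k) (map_smul φ' (MulOpposite.op r) c)
    refine LinearMap.ext fun c => AddMonoidHom.ext fun k => ?_
    change l (tmul R ℤ c k) = 0
    rw [Subsingleton.elim (tmul R ℤ c k) 0, map_zero]
  refine subsingleton_of_forall_eq 0 fun k => CharacterModule.eq_zero_of_character_apply fun χ => ?_
  exact congrArg (fun χ : D => χ k) (hD.elim χ 0)

/-- Through `ν`, the map `C ⊗ Hom(C, g)` becomes the surjection `g`, so `C ⊗ -` kills the cokernel
of `Hom(C, g)`; right faithfulness makes that cokernel zero. -/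
theorem map_surjective_of_bass (hC : IsFaithfullySemidualizing R S C)
    (hg : Function.Surjective g) (h : BassClass R S C N) (h'' : BassClass R S C N'') :
    Function.Surjective (BimodHom.map R S C g) := by
  let G := BimodHom.map R S C g
  let K := BimodHom R S C N'' ⧸ LinearMap.range G
  have hG : Function.Surjective (BalTensor.map R S C G) := by
    refine (Function.Surjective.of_comp_iff' h''.b3 _).1 ?_
    have e : (evalNu R S C N'' : _ → _) ∘ BalTensor.map R S C G = g ∘ evalNu R S C N :=
      funext fun t => evalNu_map g t
    rw [e]
    exact hg.comp h.b3.2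
  have hex : Function.Exact G (LinearMap.range G).mkQ := LinearMap.exact_map_mkQ_range G
  have hq : Function.Surjective (LinearMap.range G).mkQ := Submodule.mkQ_surjective _
  have hK : Subsingleton K := by
    refine subsingleton_of_subsingleton_tensor hC K ?_
    refine (equivInt R S C K).symm.toEquiv.subsingleton_congr.2
      (subsingleton_of_forall_eq 0 fun t => ?_)
    obtain ⟨t, rfl⟩ := BalTensor.map_surjective hq t
    obtain ⟨t, rfl⟩ := hG t
    exact (map_exact' hex hq).apply_apply_eq_zero t
  intro φ
  exact (hex φ).1 (Subsingleton.elim _ _)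

theorem BassClass.kernel (hC : IsFaithfullySemidualizing R S C) (hf : Function.Injective f)
    (hfg : Function.Exact f g) (hg : Function.Surjective g) (h : BassClass R S C N)
    (h'' : BassClass R S C N'') : BassClass R S C N' := by
  have hsurj := map_surjective_of_bass hC hg h h''
  have hinj := BimodHom.map_injective (R := R) (C := C) hf
  have hex := BimodHom.map_exact (R := R) (C := C) hf hfg
  refine ⟨fun i hi => ?_, fun i hi => ?_, ?_⟩
  · obtain ⟨i, rfl⟩ := Nat.exists_eq_add_of_le' hi
    cases i with
    | zero => exact ext_one_of_hom_lift _ hf hfg hg (h.b1 1 le_rfl) hsurj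
    | succ i => exact ext_succ_of_shortExact _ hf hfg hg (i + 1) (h.b1 _ hi) (h''.b1 _ (by lia))
  · obtain ⟨i, rfl⟩ := Nat.exists_eq_add_of_le' hi
    exact tor_succ_of_shortExact hinj hex hsurj i (h.b2 _ hi) (h''.b2 _ (by lia))
  · exact bijective_of_kernels (α := (evalNu R S C N').toAddMonoidHom)
      (β := (evalNu R S C N).toAddMonoidHom) (γ := (evalNu R S C N'').toAddMonoidHom)
      ((map_injective_iff _).2 (map_injective_of_tor_one hinj hex hsurj (h''.b2 1 le_rfl))) hf
      (map_exact' hex hsurj) hfg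
      (fun x => evalNu_map f x) (fun x => evalNu_map g x) h.b3 h''.b3.1

end Closure

end Evaluation

/-! ### Finite resolutions and coresolutions, one step at a time. -/

section Resolutions

variable {A : Type u} [Ring A] {P : ObjectProperty (ModuleCat.{u} A)}

/-- The sequence is padded with zero modules, and those in positions `1` to `n` must themselves lie
in `P`; hence `h0`. -/
theorem HasResolutionLE.of_mem {M : ModuleCat.{u} A} (hM : P M) (h0 : P (ModuleCat.of A PUnit))
    (n : ℕ) : HasResolutionLE P n M := by
  refine ⟨consObj M fun _ => ModuleCat.of A PUnit, consMap 0 fun _ => 0, 𝟙 M,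
    Function.surjective_id, ?_, ?_, ?_, ?_⟩
  · exact fun x => ⟨fun h => ⟨0, h.symm⟩, fun ⟨_, h⟩ => h.symm⟩
  · rintro (_ | i)
    · exact fun x => ⟨fun _ => ⟨0, rfl⟩, fun _ => rfl⟩
    · exact fun x => ⟨fun _ => ⟨0, rfl⟩, fun _ => rfl⟩
  · rintro (_ | i) -
    · exact hM
    · exact h0
  · rintro (_ | i) hi
    · exact absurd hi (Nat.not_lt_zero n)
    · exact inferInstanceAs (Subsingleton PUnit)

theorem HasResolutionLE.exists_iso {M : ModuleCat.{u} A} (h : HasResolutionLE P 0 M) :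
    ∃ X, P X ∧ Nonempty (X ≅ M) := by
  obtain ⟨X, d, ε, hε, h0, -, hP, hs⟩ := h
  have := hs 1 Nat.one_pos
  have hinj : Function.Injective ε.hom := (injective_iff_map_eq_zero _).2 fun x hx => by
    obtain ⟨y, rfl⟩ := (h0 x).1 hx
    rw [Subsingleton.elim y 0]
    exact map_zero (d 0).hom
  exact ⟨X 0, hP 0 le_rfl, ⟨(LinearEquiv.ofBijective ε.hom ⟨hinj, hε⟩).toModuleIso⟩⟩

theorem HasResolutionLE.cons {K X M : ModuleCat.{u} A} {a : K →ₗ[A] X} {b : X →ₗ[A] M} {n : ℕ}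
    (ha : Function.Injective a) (hab : Function.Exact a b) (hb : Function.Surjective b)
    (hX : P X) (hK : HasResolutionLE P n K) : HasResolutionLE P (n + 1) M := by
  obtain ⟨Y, d, ε, hε, h0, hd, hP, hs⟩ := hK
  refine ⟨consObj X Y, consMap (ε ≫ ModuleCat.ofHom a) d, ModuleCat.ofHom b, hb, ?_, ?_, ?_, ?_⟩
  · intro x
    refine (hab x).trans ⟨?_, ?_⟩
    · rintro ⟨y, rfl⟩
      obtain ⟨z, rfl⟩ := hε y
      exact ⟨z, rfl⟩
    · rintro ⟨z, rfl⟩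
      exact ⟨ε z, rfl⟩
  · rintro (_ | i)
    · intro x
      refine Iff.trans ?_ (h0 x)
      exact map_eq_zero_iff a ha
    · exact hd i
  · rintro (_ | i) hi
    · exact hX
    · exact hP i (Nat.le_of_succ_le_succ hi)
  · rintro (_ | i) hi
    · exact absurd hi (Nat.not_lt_zero _)
    · exact hs i (Nat.lt_of_succ_lt_succ hi)

theorem HasResolutionLE.exists_shortExact {M : ModuleCat.{u} A} {n : ℕ}
    (h : HasResolutionLE P (n + 1) M) : ∃ (K X : ModuleCat.{u} A) (a : K →ₗ[A] X) (b : X →ₗ[A] M),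
      Function.Injective a ∧ Function.Exact a b ∧ Function.Surjective b ∧ P X ∧
        HasResolutionLE P n K := by
  obtain ⟨X, d, ε, hε, h0, hd, hP, hs⟩ := h
  let q : X 1 →ₗ[A] LinearMap.ker ε.hom :=
    LinearMap.codRestrict _ (d 0).hom fun x => h0.apply_apply_eq_zero x
  refine ⟨ModuleCat.of A (LinearMap.ker ε.hom), X 0, (LinearMap.ker ε.hom).subtype, ε.hom,
    Submodule.subtype_injective _, LinearMap.exact_subtype_ker_map _, hε, hP 0 (Nat.zero_le _),
    fun i => X (i + 1), fun i => d (i + 1), ModuleCat.ofHom q, ?_, ?_, fun i => hd (i + 1),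
    fun i hi => hP _ (Nat.succ_le_succ hi), fun i hi => hs _ (Nat.succ_lt_succ hi)⟩
  · rintro ⟨x, hx⟩
    obtain ⟨y, hy⟩ := (h0 x).1 hx
    exact ⟨y, Subtype.ext hy⟩
  · intro x
    refine Iff.trans ?_ (hd 0 x)
    exact Submodule.coe_eq_zero.symm

/-- The maps `Q → X 0 → X 1 → ⋯` of a sequence lengthened to the left. -/
def consCoMap {Q : ModuleCat.{u} A} {X : ℕ → ModuleCat.{u} A} (q : Q ⟶ X 0)
    (d : ∀ i, X i ⟶ X (i + 1)) : ∀ i, consObj Q X i ⟶ consObj Q X (i + 1)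
  | 0 => q
  | n + 1 => d n

theorem HasCoresolutionLE.of_mem {M : ModuleCat.{u} A} (hM : P M)
    (h0 : P (ModuleCat.of A PUnit)) (n : ℕ) : HasCoresolutionLE P n M := by
  refine ⟨consObj M fun _ => ModuleCat.of A PUnit, consCoMap 0 fun _ => 0, 𝟙 M,
    Function.injective_id, ?_, ?_, ?_, ?_⟩
  · exact fun x => ⟨fun _ => ⟨x, rfl⟩, fun _ => rfl⟩
  · rintro (_ | i)
    · exact fun x => ⟨fun _ => ⟨0, rfl⟩, fun _ => rfl⟩
    · exact fun x => ⟨fun _ => ⟨0, rfl⟩, fun _ => rfl⟩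
  · rintro (_ | i) -
    · exact hM
    · exact h0
  · rintro (_ | i) hi
    · exact absurd hi (Nat.not_lt_zero n)
    · exact inferInstanceAs (Subsingleton PUnit)

theorem HasCoresolutionLE.exists_iso {M : ModuleCat.{u} A} (h : HasCoresolutionLE P 0 M) :
    ∃ X, P X ∧ Nonempty (M ≅ X) := by
  obtain ⟨X, d, η, hη, h0, -, hP, hs⟩ := h
  have := hs 1 Nat.one_pos
  have hsurj : Function.Surjective η.hom := fun x => (h0 x).1 (Subsingleton.elim _ _)
  exact ⟨X 0, hP 0 le_rfl, ⟨(LinearEquiv.ofBijective η.hom ⟨hη, hsurj⟩).toModuleIso⟩⟩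

theorem HasCoresolutionLE.cons {M X Q : ModuleCat.{u} A} {a : M →ₗ[A] X} {b : X →ₗ[A] Q} {n : ℕ}
    (ha : Function.Injective a) (hab : Function.Exact a b) (hb : Function.Surjective b)
    (hX : P X) (hQ : HasCoresolutionLE P n Q) : HasCoresolutionLE P (n + 1) M := by
  obtain ⟨Y, d, η, hη, h0, hd, hP, hs⟩ := hQ
  refine ⟨consObj X Y, consCoMap (ModuleCat.ofHom b ≫ η) d, ModuleCat.ofHom a, ha, ?_, ?_, ?_, ?_⟩
  · intro x
    refine Iff.trans ?_ (hab x)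
    exact map_eq_zero_iff η.hom hη
  · rintro (_ | i)
    · intro x
      refine (h0 x).trans ⟨?_, ?_⟩
      · rintro ⟨y, rfl⟩
        obtain ⟨z, rfl⟩ := hb y
        exact ⟨z, rfl⟩
      · rintro ⟨z, rfl⟩
        exact ⟨b z, rfl⟩
    · exact hd i
  · rintro (_ | i) hi
    · exact hX
    · exact hP i (Nat.le_of_succ_le_succ hi)
  · rintro (_ | i) hi
    · exact absurd hi (Nat.not_lt_zero _)
    · exact hs i (Nat.lt_of_succ_lt_succ hi)

theorem HasCoresolutionLE.exists_shortExact {M : ModuleCat.{u} A} {n : ℕ}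
    (h : HasCoresolutionLE P (n + 1) M) :
    ∃ (X Q : ModuleCat.{u} A) (a : M →ₗ[A] X) (b : X →ₗ[A] Q),
      Function.Injective a ∧ Function.Exact a b ∧ Function.Surjective b ∧ P X ∧
        HasCoresolutionLE P n Q := by
  obtain ⟨X, d, η, hη, h0, hd, hP, hs⟩ := h
  let D := LinearMap.range (d 0).hom
  refine ⟨X 0, ModuleCat.of A D, η.hom, (d 0).hom.rangeRestrict, hη, ?_,
    LinearMap.surjective_rangeRestrict _, hP 0 (Nat.zero_le _),
    fun i => X (i + 1), fun i => d (i + 1), ModuleCat.ofHom D.subtype,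
    Submodule.subtype_injective _, ?_, fun i => hd (i + 1),
    fun i hi => hP _ (Nat.succ_le_succ hi), fun i hi => hs _ (Nat.succ_lt_succ hi)⟩
  · intro x
    refine Iff.trans ?_ (h0 x)
    exact Submodule.coe_eq_zero.symm
  · intro x
    refine (hd 0 x).trans ⟨?_, ?_⟩
    · rintro ⟨y, rfl⟩
      exact ⟨⟨_, y, rfl⟩, rfl⟩
    · rintro ⟨⟨_, y, rfl⟩, rfl⟩
      exact ⟨y, rfl⟩

end Resolutions

/-! ### Short exact sequences that lower the weak dimensions. -/

section WeakClasses

variable {R S : Type u} [Ring R] [Ring S]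

theorem WF.of_iso {M M' : ModuleCat.{u} R} (e : M ≅ M') (h : WF R M) : WF R M' :=
  fun F hF => (subsingleton_tor_iff_of_iso F e 1).1 (h F hF)

theorem WI.of_iso {N N' : ModuleCat.{u} S} (e : N ≅ N') (h : WI S N) : WI S N' :=
  fun F hF => subsingleton_ext_of_iso F e 1 (h F hF)

theorem WF_of_projective (M : ModuleCat.{u} R) [Projective M] : WF R M :=
  fun F _ => tor_projective M F 0

theorem WI_of_injective (N : ModuleCat.{u} S) [Injective N] : WI S N :=
  fun F _ => Ext.subsingleton_of_injective F N 0

theorem WF_punit : WF R (ModuleCat.of R PUnit) := by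
  have : Projective (ModuleCat.of R PUnit.{u + 1}) :=
    (ModuleCat.isZero_of_subsingleton (ModuleCat.of R PUnit.{u + 1})).projective
  exact WF_of_projective _

theorem WI_punit : WI S (ModuleCat.of S PUnit) := by
  have : Injective (ModuleCat.of S PUnit.{u + 1}) :=
    (ModuleCat.isZero_of_subsingleton (ModuleCat.of S PUnit.{u + 1})).injective
  exact WI_of_injective _

theorem WF_le_WFLE (n : ℕ) : WF R ≤ WFLE R n := fun _ hM =>
  WFLE_iff.2 (tor_of_forall_superFinitelyPresented (k := 0) hM n (Nat.zero_le n))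

theorem WI_le_WILE (n : ℕ) : WI S ≤ WILE S n := fun _ hN =>
  WILE_iff.2 (ext_of_forall_superFinitelyPresented (k := 0) hN n (Nat.zero_le n))

theorem WFLE_succ_of_shortExact {K X M : ModuleCat.{u} R} {a : K →ₗ[R] X} {b : X →ₗ[R] M} {n : ℕ}
    (ha : Function.Injective a) (hab : Function.Exact a b) (hb : Function.Surjective b)
    (hX : WF R X) (hK : WFLE R n K) : WFLE R (n + 1) M :=
  WFLE_iff.2 fun F hF => tor_succ_succ_of_shortExact ha hab hb n (WFLE_iff.1 hK F hF)
    (WFLE_iff.1 (WF_le_WFLE (n + 1) _ hX) F hF)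

/-- Any projective presentation works, by dimension shifting; dually, an embedding in an injective
module serves for `WILE`. -/
theorem exists_shortExact_of_WFLE_succ {M : ModuleCat.{u} R} {n : ℕ} (h : WFLE R (n + 1) M) :
    ∃ (K X : ModuleCat.{u} R) (a : K →ₗ[R] X) (b : X →ₗ[R] M),
      Function.Injective a ∧ Function.Exact a b ∧ Function.Surjective b ∧ WF R X ∧
        WFLE R n K := by
  obtain ⟨K, X, _, _, _, _, _, a, b, ha, hab, hb⟩ := exists_projective_presentation R M
  have hX : Projective (ModuleCat.of R X) :=
    (ModuleCat.of R X).projective_of_categoryTheory_projective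
  exact ⟨ModuleCat.of R K, ModuleCat.of R X, a, b, ha, hab, hb, WF_of_projective _,
    WFLE_iff.2 fun F hF => tor_succ_of_shortExact ha hab hb n
      (tor_projective (ModuleCat.of R X) F n) (WFLE_iff.1 h F hF)⟩

theorem WILE_succ_of_shortExact {N X Q : ModuleCat.{u} S} {a : N →ₗ[S] X} {b : X →ₗ[S] Q} {n : ℕ}
    (ha : Function.Injective a) (hab : Function.Exact a b) (hb : Function.Surjective b)
    (hX : WI S X) (hQ : WILE S n Q) : WILE S (n + 1) N :=
  WILE_iff.2 fun F hF => ext_succ_of_shortExact F ha hab hb (n + 1)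
    (WILE_iff.1 (WI_le_WILE (n + 1) _ hX) F hF) (WILE_iff.1 hQ F hF)

theorem exists_shortExact_of_WILE_succ {N : ModuleCat.{u} S} {n : ℕ} (h : WILE S (n + 1) N) :
    ∃ (X Q : ModuleCat.{u} S) (a : N →ₗ[S] X) (b : X →ₗ[S] Q),
      Function.Injective a ∧ Function.Exact a b ∧ Function.Surjective b ∧ WI S X ∧
        WILE S n Q := by
  let X := Injective.under N
  let a : N →ₗ[S] X := (Injective.ι N).hom
  have ha : Function.Injective a := (ModuleCat.mono_iff_injective _).1 inferInstance
  have hab : Function.Exact a (LinearMap.range a).mkQ := LinearMap.exact_map_mkQ_range a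
  have hb : Function.Surjective (LinearMap.range a).mkQ := Submodule.mkQ_surjective _
  exact ⟨X, ModuleCat.of S (X ⧸ LinearMap.range a), a, (LinearMap.range a).mkQ, ha, hab, hb,
    WI_of_injective _, WILE_iff.2 fun F hF => ext_of_shortExact F ha hab hb (n + 1)
      (Ext.subsingleton_of_injective F X n) (WILE_iff.1 h F hF)⟩

end WeakClasses

/-! ### The Foxby equivalence. -/

section FoxbyEquivalence

variable {R S : Type u} [Ring R] [Ring S]
variable {C : Type u} [AddCommGroup C] [Module S C] [Module Rᵐᵒᵖ C]

theorem WFC_tensor {M : ModuleCat.{u} R} (hM : WF R M) :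
    WFC R S C ((tensorFunctor R S C).obj M) := ⟨M, hM, ⟨Iso.refl _⟩⟩

theorem WFC_punit : WFC R S C (ModuleCat.of S PUnit) := by
  refine ⟨ModuleCat.of R PUnit, WF_punit, ⟨Limits.IsZero.iso
    (ModuleCat.isZero_of_subsingleton (ModuleCat.of S PUnit.{u + 1})) ?_⟩⟩
  exact Functor.map_isZero (tensorFunctor R S C)
    (ModuleCat.isZero_of_subsingleton (ModuleCat.of R PUnit.{u + 1}))

variable [SMulCommClass S Rᵐᵒᵖ C]

theorem WIC_hom {N : ModuleCat.{u} S} (hN : WI S N) :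
    WIC R S C ((homFunctor R S C).obj N) := ⟨N, hN, ⟨Iso.refl _⟩⟩

theorem WIC_punit : WIC R S C (ModuleCat.of R PUnit) := by
  refine ⟨ModuleCat.of S PUnit, WI_punit, ⟨Limits.IsZero.iso
    (ModuleCat.isZero_of_subsingleton (ModuleCat.of R PUnit.{u + 1})) ?_⟩⟩
  have : Subsingleton (BimodHom R S C PUnit.{u + 1}) :=
    ⟨fun _ _ => BimodHom.ext fun _ => rfl⟩
  exact ModuleCat.isZero_iff_subsingleton.2 this

theorem WFC_le_bassClass (hC : IsSemidualizing R S C) : WFC R S C ≤ BassClass R S C := by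
  rintro N ⟨F, hF, ⟨e⟩⟩
  exact (WF_le_auslanderClass hC F hF).tensor.of_iso e.symm

theorem WIC_le_auslanderClass (hC : IsSemidualizing R S C) : WIC R S C ≤ AuslanderClass R S C := by
  rintro M ⟨I, hI, ⟨e⟩⟩
  exact (WI_le_bassClass hC I hI).hom.of_iso e.symm

theorem WF_hom_of_WFC (hC : IsSemidualizing R S C) {N : ModuleCat.{u} S} (hN : WFC R S C N) :
    WF R ((homFunctor R S C).obj N) := by
  obtain ⟨F, hF, ⟨e⟩⟩ := hN
  exact hF.of_iso ((WF_le_auslanderClass hC F hF).muIso ≪≫ (homFunctor R S C).mapIso e.symm)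

theorem WI_tensor_of_WIC (hC : IsSemidualizing R S C) {M : ModuleCat.{u} R} (hM : WIC R S C M) :
    WI S ((tensorFunctor R S C).obj M) := by
  obtain ⟨I, hI, ⟨e⟩⟩ := hM
  exact hI.of_iso ((WI_le_bassClass hC I hI).nuIso.symm ≪≫ (tensorFunctor R S C).mapIso e.symm)

/-- Both conclusions are carried through one induction: the syzygy being Auslander is what makes `C
⊗ -` preserve its inclusion, and so what lets its resolution be spliced. This uses left
faithfulness. -/
theorem auslander_and_WFCLE_of_WFLE (hC : IsFaithfullySemidualizing R S C) (n : ℕ)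
    (M : ModuleCat.{u} R) (hM : WFLE R n M) :
    AuslanderClass R S C M ∧ WFCLE R S C n ((tensorFunctor R S C).obj M) := by
  induction n generalizing M with
  | zero =>
    have hM : WF R M := WFLE_iff.1 hM
    exact ⟨WF_le_auslanderClass hC.toIsSemidualizing M hM,
      HasResolutionLE.of_mem (WFC_tensor hM) WFC_punit 0⟩
  | succ n ih =>
    obtain ⟨K, X, a, b, ha, hab, hb, hX, hK⟩ := exists_shortExact_of_WFLE_succ hM
    obtain ⟨h1, h2⟩ := ih K hK
    have h3 := WF_le_auslanderClass hC.toIsSemidualizing X hX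
    exact ⟨h1.cokernel hC ha hab hb h3, HasResolutionLE.cons (K := (tensorFunctor R S C).obj K)
      (X := (tensorFunctor R S C).obj X) (map_injective_of_auslander hC ha h1 h3)
      (map_exact' hab hb) (BalTensor.map_surjective hb) (WFC_tensor hX) h2⟩

/-- `Ext¹(C, K) = 0` for the Bass syzygy `K` keeps the sequence exact under `Hom(C, -)`, so
semidualizing is enough. -/
theorem bass_and_WFLE_of_WFCLE (hC : IsSemidualizing R S C) (n : ℕ)
    (N : ModuleCat.{u} S) (hN : WFCLE R S C n N) :
    BassClass R S C N ∧ WFLE R n ((homFunctor R S C).obj N) := by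
  induction n generalizing N with
  | zero =>
    obtain ⟨X, ⟨F, hF, ⟨e'⟩⟩, ⟨e⟩⟩ := HasResolutionLE.exists_iso hN
    have hN : WFC R S C N := ⟨F, hF, ⟨e.symm ≪≫ e'⟩⟩
    exact ⟨WFC_le_bassClass hC N hN, WF_le_WFLE 0 _ (WF_hom_of_WFC hC hN)⟩
  | succ n ih =>
    obtain ⟨K, X, a, b, ha, hab, hb, hX, hK⟩ := HasResolutionLE.exists_shortExact hN
    obtain ⟨h1, h2⟩ := ih K hK
    exact ⟨h1.cokernel ha hab hb (WFC_le_bassClass hC X hX),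
      WFLE_succ_of_shortExact (K := (homFunctor R S C).obj K) (X := (homFunctor R S C).obj X)
        (BimodHom.map_injective ha) (BimodHom.map_exact ha hab) (h1.map_surjective ha hab hb)
        (WF_hom_of_WFC hC hX) h2⟩

theorem bass_and_WICLE_of_WILE (hC : IsFaithfullySemidualizing R S C) (n : ℕ)
    (N : ModuleCat.{u} S) (hN : WILE S n N) :
    BassClass R S C N ∧ WICLE R S C n ((homFunctor R S C).obj N) := by
  induction n generalizing N with
  | zero =>
    have hN : WI S N := WILE_iff.1 hN
    exact ⟨WI_le_bassClass hC.toIsSemidualizing N hN,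
      HasCoresolutionLE.of_mem (WIC_hom hN) WIC_punit 0⟩
  | succ n ih =>
    obtain ⟨X, Q, a, b, ha, hab, hb, hX, hQ⟩ := exists_shortExact_of_WILE_succ hN
    obtain ⟨h1, h2⟩ := ih Q hQ
    have h3 := WI_le_bassClass hC.toIsSemidualizing X hX
    exact ⟨BassClass.kernel hC ha hab hb h3 h1,
      HasCoresolutionLE.cons (X := (homFunctor R S C).obj X) (Q := (homFunctor R S C).obj Q)
        (BimodHom.map_injective ha) (BimodHom.map_exact ha hab)
        (map_surjective_of_bass hC hb h3 h1) (WIC_hom hX) h2⟩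

theorem auslander_and_WILE_of_WICLE (hC : IsSemidualizing R S C) (n : ℕ)
    (M : ModuleCat.{u} R) (hM : WICLE R S C n M) :
    AuslanderClass R S C M ∧ WILE S n ((tensorFunctor R S C).obj M) := by
  induction n generalizing M with
  | zero =>
    obtain ⟨X, ⟨I, hI, ⟨e'⟩⟩, ⟨e⟩⟩ := HasCoresolutionLE.exists_iso hM
    have hM : WIC R S C M := ⟨I, hI, ⟨e ≪≫ e'⟩⟩
    exact ⟨WIC_le_auslanderClass hC M hM, WI_le_WILE 0 _ (WI_tensor_of_WIC hC hM)⟩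
  | succ n ih =>
    obtain ⟨X, Q, a, b, ha, hab, hb, hX, hQ⟩ := HasCoresolutionLE.exists_shortExact hM
    obtain ⟨h1, h2⟩ := ih Q hQ
    exact ⟨AuslanderClass.kernel ha hab hb (WIC_le_auslanderClass hC X hX) h1,
      WILE_succ_of_shortExact (X := (tensorFunctor R S C).obj X)
        (Q := (tensorFunctor R S C).obj Q) (h1.map_injective ha hab hb) (map_exact' hab hb)
        (BalTensor.map_surjective hb) (WI_tensor_of_WIC hC hX) h2⟩

/-- Classes contained in the Auslander and Bass classes that are exchanged by the two functors
are equivalent. -/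
theorem restrictToEquivalence {P : ObjectProperty (ModuleCat.{u} R)}
    {Q : ObjectProperty (ModuleCat.{u} S)} (hP : P ≤ AuslanderClass R S C)
    (hQ : Q ≤ BassClass R S C) (hF : ∀ M, P M → Q ((tensorFunctor R S C).obj M))
    (hG : ∀ N, Q N → P ((homFunctor R S C).obj N)) : RestrictToEquivalence R S C P Q := by
  let F := Q.lift (P.ι ⋙ tensorFunctor R S C) fun M => hF _ M.property
  let G := P.lift (Q.ι ⋙ homFunctor R S C) fun N => hG _ N.property
  let η : 𝟭 P.FullSubcategory ≅ F ⋙ G := NatIso.ofComponents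
    (fun M => P.isoMk (hP _ M.property).muIso) fun {M M'} f => by
      ext m
      exact (map_evalMu (S := S) (C := C) f.hom.hom m).symm
  let ε : G ⋙ F ≅ 𝟭 Q.FullSubcategory := NatIso.ofComponents
    (fun N => Q.isoMk (hQ _ N.property).nuIso) fun {N N'} f => by
      ext t
      exact evalNu_map (R := R) (C := C) f.hom.hom t
  -- `Equivalence.mk` corrects only the unit, so the functor and the inverse are the prescribed
  -- restrictions definitionally.
  exact ⟨fun M => hF _ M.property, fun N => hG _ N.property, CategoryTheory.Equivalence.mk F G η ε,
    rfl, rfl⟩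

end FoxbyEquivalence

end Foxby

theorem theorem3p4 (R S : Type u) [Ring R] [Ring S]
    (C : Type u) [AddCommGroup C] [Module S C] [Module Rᵐᵒᵖ C] [SMulCommClass S Rᵐᵒᵖ C]
    (hC : Foxby.IsFaithfullySemidualizing R S C) (n : ℕ) :
    -- the five equivalences given by `C ⊗_R -` and `Hom_S(C, -)`
    (Foxby.RestrictToEquivalence R S C (Foxby.WF R) (Foxby.WFC R S C) ∧
      Foxby.RestrictToEquivalence R S C (Foxby.WFLE R n) (Foxby.WFCLE R S C n) ∧
      Foxby.RestrictToEquivalence R S C (Foxby.AuslanderClass R S C) (Foxby.BassClass R S C) ∧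
      Foxby.RestrictToEquivalence R S C (Foxby.WICLE R S C n) (Foxby.WILE S n) ∧
      Foxby.RestrictToEquivalence R S C (Foxby.WIC R S C) (Foxby.WI S)) ∧
    -- the inclusions between classes of left `R`-modules
    (Foxby.WF R ≤ Foxby.WFLE R n ∧ Foxby.WFLE R n ≤ Foxby.AuslanderClass R S C ∧
      Foxby.WIC R S C ≤ Foxby.WICLE R S C n ∧
      Foxby.WICLE R S C n ≤ Foxby.AuslanderClass R S C) ∧
    -- the inclusions between classes of left `S`-modules
    (Foxby.WFC R S C ≤ Foxby.WFCLE R S C n ∧ Foxby.WFCLE R S C n ≤ Foxby.BassClass R S C ∧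
      Foxby.WI S ≤ Foxby.WILE S n ∧ Foxby.WILE S n ≤ Foxby.BassClass R S C) := by
  have hC' := hC.toIsSemidualizing
  have hWF := Foxby.auslander_and_WFCLE_of_WFLE hC n
  have hWFC := Foxby.bass_and_WFLE_of_WFCLE hC' n
  have hWI := Foxby.bass_and_WICLE_of_WILE hC n
  have hWIC := Foxby.auslander_and_WILE_of_WICLE hC' n
  refine ⟨⟨?_, ?_, ?_, ?_, ?_⟩, ⟨Foxby.WF_le_WFLE n, fun M hM => (hWF M hM).1,
    fun M hM => Foxby.HasCoresolutionLE.of_mem hM Foxby.WIC_punit n, fun M hM => (hWIC M hM).1⟩,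
    fun N hN => Foxby.HasResolutionLE.of_mem hN Foxby.WFC_punit n, fun N hN => (hWFC N hN).1,
    Foxby.WI_le_WILE n, fun N hN => (hWI N hN).1⟩
  · exact Foxby.restrictToEquivalence (Foxby.WF_le_auslanderClass hC') (Foxby.WFC_le_bassClass hC')
      (fun M hM => Foxby.WFC_tensor hM) fun N hN => Foxby.WF_hom_of_WFC hC' hN
  · exact Foxby.restrictToEquivalence (fun M hM => (hWF M hM).1) (fun N hN => (hWFC N hN).1)
      (fun M hM => (hWF M hM).2) fun N hN => (hWFC N hN).2
  · exact Foxby.restrictToEquivalence le_rfl le_rfl (fun M hM => hM.tensor) fun N hN => hN.hom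
  · exact Foxby.restrictToEquivalence (fun M hM => (hWIC M hM).1) (fun N hN => (hWI N hN).1)
      (fun M hM => (hWIC M hM).2) fun N hN => (hWI N hN).2
  · exact Foxby.restrictToEquivalence (Foxby.WIC_le_auslanderClass hC')
      (Foxby.WI_le_bassClass hC') (fun M hM => Foxby.WI_tensor_of_WIC hC' hM)
      fun N hN => Foxby.WIC_hom hN
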